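/- Let $\lambda>0$ be such that $d=2\lambda+2$ is an integer, and let $G$ be a finite graph without self-loops (parallel edges are allowed) with edges labeled $1,\dots,E$, $E\ge 1$, external vertices labeled $1,\dots,V^{\mathrm{ext}}$, and $V^{\mathrm{int}}$ further vertices, called internal. Let every edge $e$ carry a weight $\nu_e\in\mathbb R$, and let $x_1,\dots,x_{V^{\mathrm{ext}}}\in\mathbb R^d$ be pairwise distinct. Associate to every internal vertex $v$ a variable $x_v\in\mathbb R^d$, put $Q_e=\|x_u-x_v\|^2$ for an edge $e$ between $u$ and $v$, and assume that the Feynman integral $$f_G^{(\lambda)}(x)=\Big(\prod_{v\ \mathrm{internal}}\int_{\mathbb R^d}\frac{\mathrm d^dx_v}{\pi^{d/2}}\Big)\frac{1}{\prod_e Q_e^{\lambda\nu_e}}$$ converges absolutely. Set $M_G=\lambda\sum_e\nu_e-\tfrac d2V^{\mathrm{int}}$ and assume that $M_G\notin\{0,-1,-2,\dots\}$, so that $\Gamma(M_G)$ is defined (this is automatic if no edge joins two external vertices). For a partition $p=\{p_1,\dots,p_r\}$ of a set of vertices let $\tilde\Psi_G^p(\alpha)=\sum_F\prod_{e\in F}\alpha_e$,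 where $F$ runs over all spanning forests of $G$ that consist of exactly $r$ pairwise disjoint trees $T_1,\dots,T_r$ with $p_i\subseteq T_i$ for all $i$. Let $\tilde\Psi_G=\tilde\Psi_G^p$ for the partition $p$ of the set of external vertices into singletons, and let $$\tilde\Phi_G=\sum_{1\le i<j\le V^{\mathrm{ext}}}\|x_i-x_j\|^2\,\tilde\Psi_G^{p_{ij}},$$ where $p_{ij}$ is the partition of the set of external vertices into $\{i,j\}$ and the singletons $\{k\}$ with $k\ne i,j$. Then for all integers $n_e\ge 0$ with $n_e+\lambda\nu_e>0$ for every edge $e$, $$f_G^{(\lambda)}(x)=\frac{(-1)^{\sum_e n_e}\,\Gamma(M_G)}{\prod_e\Gamma(n_e+\lambda\nu_e)}\int_\Delta\Omega\,\Big[\prod_e\alpha_e^{n_e+\lambda\nu_e-1}\partial_{\alpha_e}^{n_e}\Big]\frac{1}{\tilde\Phi_G^{M_G}\,\tilde\Psi_G^{d/2-M_G}},$$ and the right-hand side is a well-defined, absolutely convergent projective integral over the positive simplex $\Delta=\{(\alpha_1:\dots:\alpha_E)\colon\alpha_e>0\text{ for all }e\}\subset\mathbb P^{E-1}\mathbb R$,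 with $\Omega=\sum_{e=1}^E(-1)^{e-1}\alpha_e\,\mathrm d\alpha_1\wedge\dots\wedge\widehat{\mathrm d\alpha_e}\wedge\dots\wedge\mathrm d\alpha_E$. That is, the integrand without $\Omega$ is homogeneous of degree $-E$ on the positive orthant, and for every edge $e_0$ the integral may be computed in the affine chart $\alpha_{e_0}=1$ by integrating each $\alpha_e$ with $e\ne e_0$ from $0$ to $\infty$. -/

import Mathlib

open MeasureTheory

noncomputable section

/-- A Feynman graph: a finite undirected graph without self-loops (parallel edges are allowed)
with external vertices labeled by `Fin m`, internal vertices labeled by `Fin k`, and edges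
labeled by `Fin N`.  The endpoints of an edge form an unordered pair of distinct vertices. -/
structure FeynmanGraph (m k N : ℕ) where
  ends : Fin N → Sym2 (Fin m ⊕ Fin k)
  loopless : ∀ e, ¬ (ends e).IsDiag

namespace FeynmanGraph

variable {m k N d : ℕ}

/-- The quadratic form `Q_e = ‖y_u - y_v‖ ^ 2` of an edge `e` between `u` and `v`, for positions
`y` of all the vertices in Euclidean space. -/
def Q (G : FeynmanGraph m k N) (y : Fin m ⊕ Fin k → EuclideanSpace ℝ (Fin d)) (e : Fin N) : ℝ :=
  Sym2.lift ⟨fun u v => ‖y u - y v‖ ^ 2, fun u v => by simp only [norm_sub_rev]⟩ (G.ends e)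

/-- The position space integrand `1 / ∏_e Q_e ^ (lam * ν_e)`, as a function of the positions `y`
of the internal vertices, for fixed positions `x` of the external vertices. -/
def positionIntegrand (G : FeynmanGraph m k N) (lam : ℝ) (ν : Fin N → ℝ)
    (x : Fin m → EuclideanSpace ℝ (Fin d)) (y : Fin k → EuclideanSpace ℝ (Fin d)) : ℝ :=
  1 / ∏ e, G.Q (Sum.elim x y) e ^ (lam * ν e)

/-- (Absolute) convergence of the position space Feynman integral. The integrand is
nonnegative. -/
def Converges (G : FeynmanGraph m k N) (lam : ℝ) (ν : Fin N → ℝ)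
    (x : Fin m → EuclideanSpace ℝ (Fin d)) : Prop :=
  Integrable (G.positionIntegrand lam ν x) volume

/-- The position space Feynman integral `f_G(x)`; each internal vertex is integrated over `ℝ^d`
with the measure `dy / π ^ (d / 2)`. -/
def feynmanIntegral (G : FeynmanGraph m k N) (lam : ℝ) (ν : Fin N → ℝ)
    (x : Fin m → EuclideanSpace ℝ (Fin d)) : ℝ :=
  (1 / (Real.pi ^ ((d : ℝ) / 2)) ^ k) * ∫ y, G.positionIntegrand lam ν x y

/-- The simple graph on all the vertices whose adjacencies are given by the edges in `F`. -/
def edgeGraph (G : FeynmanGraph m k N) (F : Finset (Fin N)) : SimpleGraph (Fin m ⊕ Fin k) :=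
  SimpleGraph.fromEdgeSet (G.ends '' (F : Set (Fin N)))

/-- `F` is (the edge set of) a spanning forest associated to a partition `p` of a set of vertices:
it has no cycles (in particular no two parallel edges), and its connected components, which are
trees covering all the vertices, can be labeled bijectively as `T s`, with `s` ranging over the
parts of `p`, such that `s ⊆ T s`. -/
def IsSpanningForest (G : FeynmanGraph m k N) (p : Finset (Finset (Fin m ⊕ Fin k)))
    (F : Finset (Fin N)) : Prop :=
  Set.InjOn G.ends (F : Set (Fin N)) ∧ (G.edgeGraph F).IsAcyclic ∧
    ∃ T : p ≃ (G.edgeGraph F).ConnectedComponent,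
      ∀ s : p, ((s : Finset (Fin m ⊕ Fin k)) : Set (Fin m ⊕ Fin k)) ⊆ (T s).supp

open Classical in
/-- The dual spanning forest polynomial `∑_F ∏_{e ∈ F} α_e` associated to `p`. -/
def dualForestPoly (G : FeynmanGraph m k N) (p : Finset (Finset (Fin m ⊕ Fin k)))
    (α : Fin N → ℝ) : ℝ :=
  ∑ F : Finset (Fin N) with G.IsSpanningForest p F, ∏ e ∈ F, α e

/-- The partition of the set of external vertices into singletons. -/
def singletonPartition (m k : ℕ) : Finset (Finset (Fin m ⊕ Fin k)) :=
  Finset.univ.image fun l : Fin m => {Sum.inl l}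

/-- The partition of the set of external vertices whose parts are `{i, j}` and the singletons
`{l}` with `l ≠ i, j`. -/
def pairPartition (m k : ℕ) (i j : Fin m) : Finset (Finset (Fin m ⊕ Fin k)) :=
  insert {Sum.inl i, Sum.inl j}
    ((Finset.univ.filter fun l : Fin m => l ≠ i ∧ l ≠ j).image fun l => {Sum.inl l})

/-- The polynomial `Ψ̃`. -/
def PsiDual (G : FeynmanGraph m k N) (α : Fin N → ℝ) : ℝ :=
  G.dualForestPoly (singletonPartition m k) α

/-- The polynomial `Φ̃`. -/
def PhiDual (G : FeynmanGraph m k N) (x : Fin m → EuclideanSpace ℝ (Fin d))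
    (α : Fin N → ℝ) : ℝ :=
  ∑ i : Fin m, ∑ j : Fin m with i < j,
    ‖x i - x j‖ ^ 2 * G.dualForestPoly (pairPartition m k i j) α

/-- The superficial degree of divergence `M_G = lam * ν_G - (d / 2) * V^int` in dimension `d`, for
a graph with `k` internal vertices and edge weights `ν`. -/
def superficialDegree (_G : FeynmanGraph m k N) (d : ℕ) (lam : ℝ) (ν : Fin N → ℝ) : ℝ :=
  lam * ∑ e, ν e - (d : ℝ) / 2 * k

end FeynmanGraph

/-- The partial derivative `∂f/∂α_e`. -/
def partialDeriv {N : ℕ} (e : Fin N) (f : (Fin N → ℝ) → ℝ) : (Fin N → ℝ) → ℝ :=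
  fun α => lineDeriv ℝ f α (Pi.single e 1)

/-- The iterated partial derivative `∂_{α_1}^{n_1} ⋯ ∂_{α_N}^{n_N} f`. -/
def multiPartialDeriv {N : ℕ} (n : Fin N → ℕ) (f : (Fin N → ℝ) → ℝ) : (Fin N → ℝ) → ℝ :=
  (List.finRange N).foldr (fun e g => (partialDeriv e)^[n e] g) f

/-- The dual parametric integrand
`[∏_e α_e ^ (n_e + lam ν_e - 1) ∂_{α_e}^{n_e}] (1 / (Φ̃ ^ M_G * Ψ̃ ^ (d / 2 - M_G)))`. -/
def FeynmanGraph.dualIntegrand {m k N d : ℕ} (G : FeynmanGraph m k N) (lam : ℝ) (ν : Fin N → ℝ)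
    (x : Fin m → EuclideanSpace ℝ (Fin d)) (n : Fin N → ℕ) (α : Fin N → ℝ) : ℝ :=
  (∏ e, α e ^ ((n e : ℝ) + lam * ν e - 1)) *
    multiPartialDeriv n (fun a => 1 / (G.PhiDual x a ^ G.superficialDegree d lam ν *
      G.PsiDual a ^ ((d : ℝ) / 2 - G.superficialDegree d lam ν))) α

/-- The point of the affine chart `α_{e₀} = 1` of projective space with the remaining homogeneous
coordinates given by `b`. -/
def affineChart {N : ℕ} (e₀ : Fin N) (b : {e : Fin N // e ≠ e₀} → ℝ) : Fin N → ℝ :=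
  fun e => if h : e = e₀ then 1 else b ⟨e, h⟩

/-- The integral of `F Ω` over the positive simplex in projective space, computed in the affine
chart `α_{e₀} = 1`: the other coordinates are integrated from `0` to `∞`. -/
def projectiveIntegral {N : ℕ} (e₀ : Fin N) (F : (Fin N → ℝ) → ℝ) : ℝ :=
  ∫ b in {b : {e : Fin N // e ≠ e₀} → ℝ | ∀ e, 0 < b e}, F (affineChart e₀ b)

/-- `F Ω` defines an absolutely convergent integral over the positive simplex in projective space:
`F` is homogeneous of degree `-N` on the positive orthant, so that `F Ω` descends to projective
space, and `F Ω` is absolutely integrable in every affine chart `α_{e₀} = 1`. -/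
structure ConvergentProjective {N : ℕ} (F : (Fin N → ℝ) → ℝ) : Prop where
  homogeneous : ∀ α : Fin N → ℝ, (∀ e, 0 < α e) → ∀ t : ℝ, 0 < t →
    F (fun e => t * α e) = t ^ (-(N : ℤ)) * F α
  integrable : ∀ e₀ : Fin N, IntegrableOn (fun b => F (affineChart e₀ b))
    {b : {e : Fin N // e ≠ e₀} → ℝ | ∀ e, 0 < b e}

end

/-! Put `A_e = n_e + λν_e > 0`. Writing `Q_e^(-λν_e) = Q_e^(n_e) Q_e^(-A_e)` and applying
Schwinger's formula to the last factor turns the Feynman integral into an integral over `α` and the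
internal positions `y` of `∏ α_e^(A_e - 1) ∏ Q_e^(n_e) exp(-∑ α_e Q_e)`. Everything is nonnegative,
so Tonelli allows the `y` integral to be done first. Without the insertions it is a Gaussian with
value `π^(dk/2) Ψ̃^(-d/2) exp(-Φ̃/Ψ̃)`, and the insertions `Q_e^(n_e)` are produced by the
derivatives `(-∂_e)^(n_e)`.

The graph polynomials enter through determinants. The quadratic form of the Gaussian is the
Laplacian on the internal vertices, with determinant `Ψ̃` (`det_weightedGram_inc`). Its minimum is a
Schur complement, hence a bordered determinant over `Ψ̃`; summed over the `d` coordinates this gives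
`Φ̃/Ψ̃` (`sum_minQuad`). Both determinants are computed by Cauchy–Binet and the unimodularity of
incidence minors (`det_inc_int_sq`).

The rays in `α` space are then integrated: `α = tβ` with `β` in an affine chart. Formally the `t`
integral is the Mellin transform `∫ t^(M-1) exp(-tΦ̃/Ψ̃) dt = Γ(M) (Φ̃/Ψ̃)^(-M)`, which together
with `Ψ̃^(-d/2)` is `Γ(M)` times the dual kernel. But `M = M_G` may be negative, and then this
transform diverges and cannot be exchanged with the derivatives. Instead, `exists_listDeriv_eq_sum`
shows that the derivatives of `w φ_0(u)` have the form `∑ g_j φ_j(u)`, with the same `g_j` for every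
sequence satisfying `φ_j' = -φ_(j+1)`. It is applied to `t^j exp(-tr)` and to `Γ(M+j) r^(-(M+j))`.
By Tonelli the radial integral of the whole sum converges for almost every `β`, and a convergent
integral of this kind has the analytically continued value (`integral_rpow_mul_sum_mul_exp`): for `M
≤ 0` convergence forces the leading coefficient to vanish, which permits the shift from `M` to `M +
1`.

Positivity of `Ψ̃` and `Φ̃` on the open orthant also follows from convergence: a zero would give a
linear map, or a dilation about a point, that rescales the position space integrand with a factor
incompatible with its determinant (`PsiDual_pos`, `PhiDual_pos`). -/

noncomputable section

namespace FeynmanGraph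

variable {m k N d : ℕ}

/-! ### Incidence vectors and forests -/

/-- The first endpoint of an edge, for some fixed choice of orientation. -/
def src (G : FeynmanGraph m k N) (e : Fin N) : Fin m ⊕ Fin k := (G.ends e).out.1

/-- The second endpoint of an edge, for some fixed choice of orientation. -/
def tgt (G : FeynmanGraph m k N) (e : Fin N) : Fin m ⊕ Fin k := (G.ends e).out.2

lemma mk_src_tgt (G : FeynmanGraph m k N) (e : Fin N) : s(G.src e, G.tgt e) = G.ends e :=
  Quot.out_eq (G.ends e)

lemma src_ne_tgt (G : FeynmanGraph m k N) (e : Fin N) : G.src e ≠ G.tgt e := by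
  have h := G.loopless e
  rw [← mk_src_tgt] at h
  simpa using h

/-- The oriented incidence matrix. -/
def inc (G : FeynmanGraph m k N) (R : Type*) [Ring R] (e : Fin N) (v : Fin m ⊕ Fin k) : R :=
  (if v = G.src e then 1 else 0) - (if v = G.tgt e then 1 else 0)

lemma sum_inc_mul (G : FeynmanGraph m k N) {R : Type*} [Ring R] (e : Fin N)
    (f : Fin m ⊕ Fin k → R) : ∑ v, G.inc R e v * f v = f (G.src e) - f (G.tgt e) := by
  simp [inc, sub_mul, Finset.sum_sub_distrib, -Fintype.sum_sum_type]

lemma edgeGraph_adj (G : FeynmanGraph m k N) (F : Finset (Fin N)) (u v : Fin m ⊕ Fin k) :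
    (G.edgeGraph F).Adj u v ↔ ∃ e ∈ F, G.ends e = s(u, v) := by
  simp only [edgeGraph, SimpleGraph.fromEdgeSet_adj, Set.mem_image, Finset.mem_coe, ne_eq,
    and_iff_left_iff_imp]
  rintro ⟨e, -, he⟩ rfl
  exact G.loopless e (by simp [he])

lemma edgeGraph_adj_src_tgt (G : FeynmanGraph m k N) {F : Finset (Fin N)} {e : Fin N}
    (he : e ∈ F) : (G.edgeGraph F).Adj (G.src e) (G.tgt e) :=
  (G.edgeGraph_adj F _ _).2 ⟨e, he, (G.mk_src_tgt e).symm⟩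

lemma eq_of_ends_eq (G : FeynmanGraph m k N) {A : Type*} {f : Fin m ⊕ Fin k → A} {e : Fin N}
    {u v : Fin m ⊕ Fin k} (he : G.ends e = s(u, v)) (h : f (G.src e) = f (G.tgt e)) :
    f u = f v := by
  rw [← mk_src_tgt, Sym2.eq_iff] at he
  rcases he with ⟨rfl, rfl⟩ | ⟨rfl, rfl⟩
  · exact h
  · exact h.symm

lemma _root_.SimpleGraph.Reachable.apply_eq_of_adj {V A : Type*} {H : SimpleGraph V} {f : V → A}
    (h : ∀ u v, H.Adj u v → f u = f v) {u v : V} (huv : H.Reachable u v) : f u = f v := by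
  obtain ⟨p⟩ := huv
  induction p with
  | nil => rfl
  | cons hadj _ ih => exact (h _ _ hadj).trans ih

lemma apply_eq_of_reachable (G : FeynmanGraph m k N) {A : Type*} {F : Finset (Fin N)}
    {f : Fin m ⊕ Fin k → A} (h : ∀ e ∈ F, f (G.src e) = f (G.tgt e)) {u v : Fin m ⊕ Fin k}
    (huv : (G.edgeGraph F).Reachable u v) : f u = f v := by
  refine huv.apply_eq_of_adj fun u v hadj => ?_
  obtain ⟨e, he, hev⟩ := (G.edgeGraph_adj F u v).1 hadj
  exact G.eq_of_ends_eq hev (h e he)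

/-- The coboundary map `f ↦ (f (src e) - f (tgt e))_{e ∈ F}`. -/
def coboundary (G : FeynmanGraph m k N) (F : Finset (Fin N)) :
    (Fin m ⊕ Fin k → ℝ) →ₗ[ℝ] (F → ℝ) where
  toFun f e := f (G.src e) - f (G.tgt e)
  map_add' f g := by ext e; simp; ring
  map_smul' c f := by ext e; simp; ring

/-- A potential with zero coboundary is constant on components, so rank–nullity turns component
counts into ranks. -/
lemma ker_coboundary (G : FeynmanGraph m k N) (F : Finset (Fin N)) :
    LinearMap.ker (G.coboundary F) =
      LinearMap.range (LinearMap.funLeft ℝ ℝ (G.edgeGraph F).connectedComponentMk) := by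
  ext f
  simp only [LinearMap.mem_ker, LinearMap.mem_range]
  constructor
  · intro h
    have h' : ∀ e ∈ F, f (G.src e) = f (G.tgt e) := fun e he =>
      sub_eq_zero.1 (congrFun h ⟨e, he⟩)
    refine ⟨fun c => c.lift f fun v w p _ => G.apply_eq_of_reachable h' ⟨p⟩, ?_⟩
    ext v
    rfl
  · rintro ⟨g, rfl⟩
    ext ⟨e, he⟩
    have : (G.edgeGraph F).connectedComponentMk (G.src e) =
        (G.edgeGraph F).connectedComponentMk (G.tgt e) :=
      SimpleGraph.ConnectedComponent.sound (G.edgeGraph_adj_src_tgt he).reachable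
    simp [coboundary, LinearMap.funLeft_apply, this]

instance (G : FeynmanGraph m k N) (F : Finset (Fin N)) :
    Finite (G.edgeGraph F).ConnectedComponent :=
  Quot.finite _

lemma finrank_range_coboundary (G : FeynmanGraph m k N) (F : Finset (Fin N)) :
    Module.finrank ℝ (LinearMap.range (G.coboundary F)) +
      Nat.card (G.edgeGraph F).ConnectedComponent = m + k := by
  have h := LinearMap.finrank_range_add_finrank_ker (G.coboundary F)
  have := Fintype.ofFinite (G.edgeGraph F).ConnectedComponent
  rw [ker_coboundary, LinearMap.finrank_range_of_inj
    (LinearMap.funLeft_injective_of_surjective _ _ (G.edgeGraph F).connectedComponentMk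
      Quot.mk_surjective)] at h
  simpa [Nat.card_eq_fintype_card] using h

lemma coboundary_surjective_iff (G : FeynmanGraph m k N) (F : Finset (Fin N)) :
    Function.Surjective (G.coboundary F) ↔
      F.card + Nat.card (G.edgeGraph F).ConnectedComponent = m + k := by
  have h := G.finrank_range_coboundary F
  rw [← LinearMap.range_eq_top]
  constructor
  · intro h'
    rw [h', finrank_top] at h
    simpa using h
  · intro h'
    apply Submodule.eq_top_of_finrank_eq
    rw [Module.finrank_fintype_fun_eq_card, Fintype.card_coe]
    omega

lemma card_le_card_add_connectedComponent (G : FeynmanGraph m k N) (F : Finset (Fin N)) :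
    m + k ≤ F.card + Nat.card (G.edgeGraph F).ConnectedComponent := by
  have h := G.finrank_range_coboundary F
  have h' := Submodule.finrank_le (LinearMap.range (G.coboundary F))
  rw [Module.finrank_fintype_fun_eq_card, Fintype.card_coe] at h'
  omega

/-- Both sides say that the coboundary map of `F` is onto, that is, that the incidence rows of `F`
are linearly independent. -/
lemma injOn_and_isAcyclic_iff (G : FeynmanGraph m k N) (F : Finset (Fin N)) :
    (Set.InjOn G.ends (F : Set (Fin N)) ∧ (G.edgeGraph F).IsAcyclic) ↔
      F.card + Nat.card (G.edgeGraph F).ConnectedComponent = m + k := by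
  classical
  rw [← coboundary_surjective_iff]
  constructor
  · rintro ⟨hinj, hac⟩
    -- Every edge of a forest is a bridge; the indicator function of the side containing its source
    -- has coboundary supported on that edge alone.
    have key : ∀ e : F, ∃ f, G.coboundary F f = Pi.single e 1 := by
      rintro ⟨e, he⟩
      have hb := SimpleGraph.isAcyclic_iff_forall_adj_isBridge.1 hac (G.edgeGraph_adj_src_tgt he)
      rw [SimpleGraph.isBridge_iff] at hb
      set H := (G.edgeGraph F).deleteEdges {s(G.src e, G.tgt e)} with hH
      refine ⟨fun v => if H.Reachable (G.src e) v then 1 else 0, ?_⟩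
      ext ⟨e', he'⟩
      by_cases hee : e' = e
      · subst hee
        simp [coboundary, hb]
      · have hadj : H.Adj (G.src e') (G.tgt e') := by
          rw [hH, SimpleGraph.deleteEdges_adj]
          refine ⟨G.edgeGraph_adj_src_tgt he', ?_⟩
          simp only [mk_src_tgt, Set.mem_singleton_iff]
          exact fun h => hee (hinj he' he h)
        have : H.Reachable (G.src e) (G.src e') ↔ H.Reachable (G.src e) (G.tgt e') :=
          ⟨fun h => h.trans hadj.reachable, fun h => h.trans hadj.reachable.symm⟩
        simp [coboundary, this, hee]
    choose f hf using key
    intro g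
    refine ⟨∑ e, g e • f e, ?_⟩
    ext e
    simp [map_sum, hf, Finset.sum_apply, Pi.single_apply]
  · intro hs
    -- A potential that jumps only across `e` rules out both an edge of `F` parallel to `e` and a
    -- path in `F` that joins the ends of `e` and avoids it.
    have key : ∀ e ∈ F, ∃ f : Fin m ⊕ Fin k → ℝ, f (G.src e) ≠ f (G.tgt e) ∧
        ∀ e' ∈ F, e' ≠ e → f (G.src e') = f (G.tgt e') := by
      intro e he
      obtain ⟨f, hf⟩ := hs (Pi.single ⟨e, he⟩ 1)
      refine ⟨f, fun h => ?_, fun e' he' hne => ?_⟩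
      · have := congrFun hf ⟨e, he⟩
        simp [coboundary, h] at this
      · have := congrFun hf ⟨e', he'⟩
        simpa [coboundary, hne, sub_eq_zero] using this
    constructor
    · intro e he e' he' h
      by_contra hne
      obtain ⟨f, hf, hf'⟩ := key e he
      exact hf (G.eq_of_ends_eq (by rw [mk_src_tgt, ← h]) (hf' e' he' (Ne.symm hne)))
    · rw [SimpleGraph.isAcyclic_iff_forall_adj_isBridge]
      intro u v huv
      rw [SimpleGraph.isBridge_iff]
      intro hr
      obtain ⟨e, he, hev⟩ := (G.edgeGraph_adj F u v).1 huv
      obtain ⟨f, hf, hf'⟩ := key e he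
      have huv' : f u = f v := by
        refine hr.apply_eq_of_adj fun a b hab => ?_
        rw [SimpleGraph.deleteEdges_adj] at hab
        obtain ⟨e', he', hev'⟩ := (G.edgeGraph_adj F a b).1 hab.1
        refine G.eq_of_ends_eq hev' (hf' e' he' ?_)
        rintro rfl
        exact hab.2 (by simp [← hev, ← hev'])
      exact hf (by
        rw [← mk_src_tgt, Sym2.eq_iff] at hev
        rcases hev with ⟨h1, h2⟩ | ⟨h1, h2⟩
        · rw [h1, h2, huv']
        · rw [h1, h2, huv'])

/-- Any edge set leaves at least `m + k - F.card` components, and a surjection from `p` bounds their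
number by `p.card`. With the right number of edges the two bounds meet, so the surjection is a
bijection and acyclicity is automatic. -/
lemma isSpanningForest_iff (G : FeynmanGraph m k N) (p : Finset (Finset (Fin m ⊕ Fin k)))
    (F : Finset (Fin N)) :
    G.IsSpanningForest p F ↔ F.card + p.card = m + k ∧
      ∃ T : p → (G.edgeGraph F).ConnectedComponent, Function.Surjective T ∧
        ∀ s : p, ((s : Finset (Fin m ⊕ Fin k)) : Set (Fin m ⊕ Fin k)) ⊆ (T s).supp := by
  have hp : Nat.card p = p.card := by simp
  rw [IsSpanningForest, ← and_assoc, injOn_and_isAcyclic_iff]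
  constructor
  · rintro ⟨h, T, hT⟩
    exact ⟨by rw [← h, ← hp, Nat.card_congr T], T, T.surjective, hT⟩
  · rintro ⟨h, T, hs, hT⟩
    have h1 := Nat.card_le_card_of_surjective T hs
    have h2 := G.card_le_card_add_connectedComponent F
    have h3 : Nat.card p = Nat.card (G.edgeGraph F).ConnectedComponent := by omega
    have hb : Function.Bijective T := (Nat.bijective_iff_surjective_and_card T).2 ⟨hs, h3⟩
    exact ⟨by omega, Equiv.ofBijective T hb, hT⟩

end FeynmanGraph

/-! ### Weighted Gram matrices and the Cauchy–Binet formula -/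

section CauchyBinet

variable {ι κ R : Type*} [Fintype ι] [DecidableEq ι] [Fintype κ] [CommRing R]

/-- The weighted Gram matrix `∑_e α_e b_e b_eᵀ`. -/
def weightedGram (b : κ → ι → R) (α : κ → R) : Matrix ι ι R :=
  Matrix.of fun i j => ∑ e, α e * b e i * b e j

/-- Each row of the Gram matrix is a combination of the vectors `b e`; the determinant is expanded
by multilinearity in the rows. -/
lemma det_weightedGram_eq_sum (b : κ → ι → R) (α : κ → R) :
    (weightedGram b α).det =
      ∑ r : ι → κ, (∏ i, α (r i)) * ((∏ i, b (r i) i) * (Matrix.of fun i => b (r i)).det) := by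
  have h : weightedGram b α = fun i => ∑ e, (α e * b e i) • b e := by
    ext i j
    simp [weightedGram, Finset.sum_apply]
  have h2 := (Matrix.detRowAlternating (n := ι) (R := R)).toMultilinearMap.map_sum
    (fun i e => (α e * b e i) • b e)
  calc (weightedGram b α).det
      = ∑ r : ι → κ, Matrix.detRowAlternating fun i => (α (r i) * b (r i) i) • b (r i) := by
        rw [h]; exact h2
    _ = _ := by
        refine Finset.sum_congr rfl fun r _ => ?_
        rw [← AlternatingMap.coe_multilinearMap, MultilinearMap.map_smul_univ,
          Finset.prod_mul_distrib, smul_eq_mul, mul_assoc]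
        rfl

/-- Cauchy–Binet. The tuples in the multilinear expansion are grouped by their image `F`. Expressing
the coefficient of `F` as a Gram determinant with indicator weights avoids choosing an order on `F`.
-/
lemma det_weightedGram [DecidableEq κ] (b : κ → ι → R) (α : κ → R) :
    (weightedGram b α).det = ∑ F : Finset κ with F.card = Fintype.card ι,
      (∏ e ∈ F, α e) * (weightedGram b fun e => if e ∈ F then 1 else 0).det := by
  have hzero : ∀ r : ι → κ, ¬ Function.Injective r →
      (Matrix.of fun i => b (r i)).det = 0 := by
    intro r hr
    simp only [Function.Injective, not_forall] at hr
    obtain ⟨i, j, hij, hne⟩ := hr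
    exact Matrix.det_zero_of_row_eq hne (by ext l; simp [hij])
  have hcard : ∀ r : ι → κ, Function.Injective r ↔
      (Finset.univ.image r).card = Fintype.card ι := fun r => by
    rw [← Finset.card_univ, Finset.card_image_iff]
    simp
  rw [det_weightedGram_eq_sum, ← Finset.sum_fiberwise (g := fun r : ι → κ => Finset.univ.image r),
    Finset.sum_filter]
  refine Finset.sum_congr rfl fun F _ => ?_
  split_ifs with hF
  · rw [det_weightedGram_eq_sum, Finset.mul_sum, Finset.sum_filter]
    refine Finset.sum_congr rfl fun r _ => ?_
    by_cases hr : Function.Injective r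
    · split_ifs with h
      · have h1 : ∀ i, r i ∈ F := fun i => h ▸ Finset.mem_image_of_mem r (Finset.mem_univ i)
        simp only [h1, if_true, Finset.prod_const_one, one_mul]
        rw [← h, Finset.prod_image fun i _ j _ hij => hr hij]
      -- An injective tuple with values in `F` would have image `F` by cardinality; otherwise an
      -- indicator weight kills its term.
      · obtain ⟨i, hi⟩ : ∃ i, r i ∉ F := by
          by_contra hcon
          push Not at hcon
          refine h (Finset.eq_of_subset_of_card_le ?_ ?_)
          · intro e he
            obtain ⟨i, -, rfl⟩ := Finset.mem_image.1 he
            exact hcon i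
          · rw [hF, (hcard r).1 hr]
        rw [Finset.prod_eq_zero (Finset.mem_univ i) (by simp [hi])]
        simp
    · simp [hzero r hr]
  · refine Finset.sum_eq_zero fun r hr => ?_
    rw [Finset.mem_filter] at hr
    rw [hzero r (fun hinj => hF (hr.2 ▸ (hcard r).1 hinj))]
    simp

lemma det_weightedGram_indicator [DecidableEq κ] (b : κ → ι → R) {F : Finset κ} (φ : ι ≃ F) :
    (weightedGram b fun e => if e ∈ F then 1 else 0).det =
      (Matrix.of fun i => b (φ i)).det ^ 2 := by
  have : (weightedGram b fun e => if e ∈ F then 1 else 0) =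
      (Matrix.of fun i => b (φ i)).transpose * Matrix.of fun i => b (φ i) := by
    ext i j
    simp only [weightedGram, Matrix.of_apply, Matrix.mul_apply, Matrix.transpose_apply, ite_mul,
      one_mul, zero_mul]
    rw [← Finset.sum_filter, Finset.filter_mem_eq_inter, Finset.univ_inter, ← Finset.sum_coe_sort]
    exact (φ.sum_comp fun e => b e i * b e j).symm
  rw [this, Matrix.det_mul, Matrix.det_transpose, sq]

end CauchyBinet

/-! ### Unimodularity of the minors of the incidence matrix -/

namespace FeynmanGraph

variable {m k N d : ℕ}

/-- Every component of the spanning subgraph with edges `F` contains a vertex of `S`. -/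
def Covers (G : FeynmanGraph m k N) (F : Finset (Fin N)) (S : Set (Fin m ⊕ Fin k)) : Prop :=
  ∀ C : (G.edgeGraph F).ConnectedComponent, ∃ v ∈ S, (G.edgeGraph F).connectedComponentMk v = C

lemma inc_mulVec (G : FeynmanGraph m k N) {R ι : Type*} [CommRing R] [Fintype ι]
    {c : ι → Fin m ⊕ Fin k} (hc : Function.Injective c) (e : Fin N) (x : ι → R) :
    ∑ j, G.inc R e (c j) * x j =
      Function.extend c x 0 (G.src e) - Function.extend c x 0 (G.tgt e) := by
  rw [← sum_inc_mul]
  refine Fintype.sum_of_injective c hc _ _ (fun v hv => ?_) fun i => ?_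
  · rw [Function.extend_apply' _ _ _ hv]; simp
  · rw [hc.extend_apply]

/-- A kernel vector of this minor is a potential that vanishes off the chosen columns and is
constant on the components of `F`. A nonzero one exists exactly when some component lies inside the
chosen columns. The criterion does not depend on the domain `R`, which is what allows reduction
modulo primes. -/
lemma det_inc_ne_zero_iff (G : FeynmanGraph m k N) {R ι : Type*} [CommRing R] [IsDomain R]
    [Fintype ι] [DecidableEq ι] {c : ι → Fin m ⊕ Fin k} (hc : Function.Injective c)
    {F : Finset (Fin N)} (φ : ι ≃ F) :
    (Matrix.of fun i j => G.inc R (φ i : Fin N) (c j)).det ≠ 0 ↔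
      G.Covers F (Set.range c)ᶜ := by
  classical
  rw [ne_eq, ← Matrix.exists_mulVec_eq_zero_iff]
  have hmul : ∀ x : ι → R, (Matrix.of fun i j => G.inc R (φ i : Fin N) (c j)).mulVec x = 0 ↔
      ∀ e ∈ F, Function.extend c x 0 (G.src e) = Function.extend c x 0 (G.tgt e) := by
    intro x
    rw [funext_iff]
    simp only [Matrix.mulVec, dotProduct, Matrix.of_apply, Pi.zero_apply, G.inc_mulVec hc,
      sub_eq_zero]
    constructor
    · intro h e he
      simpa using h (φ.symm ⟨e, he⟩)
    · intro h i
      exact h _ (φ i).2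
  constructor
  · intro h C
    by_contra hC
    push Not at hC
    apply h
    obtain ⟨v₀, hv₀⟩ := C.exists_rep
    -- As `C` meets only chosen columns, extending by zero gives the indicator function of `C` on
    -- all vertices.
    have hex : Function.extend c (fun j => if (G.edgeGraph F).connectedComponentMk (c j) = C then
        (1 : R) else 0) 0 = fun v => if (G.edgeGraph F).connectedComponentMk v = C then 1 else 0 := by
      ext v
      by_cases hv : ∃ j, c j = v
      · obtain ⟨j, rfl⟩ := hv
        rw [hc.extend_apply]
      · rw [Function.extend_apply' _ _ _ hv, if_neg (hC v hv)]
        rfl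
    refine ⟨fun j => if (G.edgeGraph F).connectedComponentMk (c j) = C then 1 else 0, ?_, ?_⟩
    · obtain ⟨j, hj⟩ : v₀ ∈ Set.range c := by
        by_contra hv
        exact hC v₀ hv hv₀
      intro h0
      have := congrFun h0 j
      subst hj
      have hv₀' : (G.edgeGraph F).connectedComponentMk (c j) = C := hv₀
      simp [hv₀'] at this
    · rw [hmul, hex]
      intro e he
      have : (G.edgeGraph F).connectedComponentMk (G.src e) =
          (G.edgeGraph F).connectedComponentMk (G.tgt e) :=
        SimpleGraph.ConnectedComponent.sound (G.edgeGraph_adj_src_tgt he).reachable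
      simp only [this]
  · rintro h ⟨x, hx, hx0⟩
    rw [hmul] at hx0
    apply hx
    ext j
    obtain ⟨v, hv, hvC⟩ := h ((G.edgeGraph F).connectedComponentMk (c j))
    have := G.apply_eq_of_reachable hx0 (SimpleGraph.ConnectedComponent.exact hvC)
    rw [hc.extend_apply, Function.extend_apply' _ _ _ hv] at this
    exact this.symm

lemma det_inc_map (G : FeynmanGraph m k N) {R ι : Type*} [CommRing R] [Fintype ι] [DecidableEq ι]
    (c : ι → Fin m ⊕ Fin k) {F : Finset (Fin N)} (φ : ι ≃ F) :
    (((Matrix.of fun i j => G.inc ℤ (φ i : Fin N) (c j)).det : ℤ) : R) =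
      (Matrix.of fun i j => G.inc R (φ i : Fin N) (c j)).det := by
  refine ((Int.castRingHom R).map_det _).trans ?_
  congr 1
  ext i j
  simp only [inc, RingHom.mapMatrix_apply, Matrix.map_apply, Matrix.of_apply, map_sub]
  congr 1 <;> split_ifs <;> simp

/-- By `det_inc_ne_zero_iff` over `ZMod p`, the integer minor is nonzero modulo every prime, so it
is `±1`. -/
lemma det_inc_int_sq (G : FeynmanGraph m k N) {ι : Type*} [Fintype ι] [DecidableEq ι]
    {c : ι → Fin m ⊕ Fin k} (hc : Function.Injective c) {F : Finset (Fin N)} (φ : ι ≃ F)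
    (h : G.Covers F (Set.range c)ᶜ) :
    (Matrix.of fun i j => G.inc ℤ (φ i : Fin N) (c j)).det ^ 2 = 1 := by
  have h1 : (Matrix.of fun i j => G.inc ℤ (φ i : Fin N) (c j)).det.natAbs = 1 := by
    rw [Nat.eq_one_iff_not_exists_prime_dvd]
    intro p hp hdvd
    have := Fact.mk hp
    refine (G.det_inc_ne_zero_iff (R := ZMod p) hc φ).2 h ?_
    rw [← G.det_inc_map, ZMod.intCast_zmod_eq_zero_iff_dvd]
    exact Int.natCast_dvd.2 hdvd
  rw [← Int.natAbs_pow_two, h1]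
  norm_num

/-! ### The all-minors matrix-tree identities -/

lemma isSpanningForest_iff_of_nonempty (G : FeynmanGraph m k N)
    {p : Finset (Finset (Fin m ⊕ Fin k))} (hp : ∀ s ∈ p, s.Nonempty) (F : Finset (Fin N)) :
    G.IsSpanningForest p F ↔ F.card + p.card = m + k ∧ G.Covers F {v | ∃ s ∈ p, v ∈ s} ∧
      ∀ s ∈ p, ∀ u ∈ s, ∀ v ∈ s, (G.edgeGraph F).connectedComponentMk u =
        (G.edgeGraph F).connectedComponentMk v := by
  rw [isSpanningForest_iff]
  refine and_congr_right fun _ => ⟨?_, ?_⟩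
  · rintro ⟨T, hT, hsub⟩
    have hmem : ∀ s (hs : s ∈ p), ∀ v ∈ s, (G.edgeGraph F).connectedComponentMk v = T ⟨s, hs⟩ :=
      fun s hs v hv => hsub ⟨s, hs⟩ hv
    refine ⟨fun C => ?_, fun s hs u hu v hv => by rw [hmem s hs u hu, hmem s hs v hv]⟩
    obtain ⟨⟨s, hs⟩, rfl⟩ := hT C
    obtain ⟨v, hv⟩ := hp s hs
    exact ⟨v, ⟨s, hs, hv⟩, hmem s hs v hv⟩
  · rintro ⟨hC, hs⟩
    refine ⟨fun s => (G.edgeGraph F).connectedComponentMk (hp s s.2).choose, fun C => ?_,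
      fun s v hv => hs s s.2 v hv _ (hp s s.2).choose_spec⟩
    obtain ⟨v, ⟨s, hsp, hv⟩, rfl⟩ := hC C
    exact ⟨⟨s, hsp⟩, hs s hsp _ (hp s hsp).choose_spec _ hv⟩

lemma card_singletonPartition (m k : ℕ) : (singletonPartition m k).card = m := by
  rw [singletonPartition, Finset.card_image_of_injective, Finset.card_univ, Fintype.card_fin]
  intro a b hab
  simpa using hab

lemma isSpanningForest_singletonPartition_iff (G : FeynmanGraph m k N) (F : Finset (Fin N)) :
    G.IsSpanningForest (singletonPartition m k) F ↔
      F.card = k ∧ G.Covers F (Set.range Sum.inl) := by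
  have hset : {v | ∃ s ∈ singletonPartition m k, v ∈ s} = Set.range Sum.inl := by
    ext v
    simp [singletonPartition, eq_comm]
  rw [isSpanningForest_iff_of_nonempty _ (by simp [singletonPartition]), card_singletonPartition, hset]
  constructor
  · rintro ⟨h1, h2, -⟩
    exact ⟨by omega, h2⟩
  · rintro ⟨h1, h2⟩
    exact ⟨by omega, h2, by simp [singletonPartition]⟩

lemma card_pairPartition {i j : Fin m} (hij : i ≠ j) : (pairPartition m k i j).card + 1 = m := by
  have h1 : ({Sum.inl i, Sum.inl j} : Finset (Fin m ⊕ Fin k)) ∉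
      (Finset.univ.filter fun l : Fin m => l ≠ i ∧ l ≠ j).image
        fun l => ({Sum.inl l} : Finset (Fin m ⊕ Fin k)) := by
    intro h
    obtain ⟨l, hl, hl'⟩ := Finset.mem_image.1 h
    have h2 := congrArg Finset.card hl'
    rw [Finset.card_pair (by simpa using hij), Finset.card_singleton] at h2
    omega
  rw [pairPartition, Finset.card_insert_of_notMem h1, Finset.card_image_of_injective]
  · have h3 : (Finset.univ.filter fun l : Fin m => l ≠ i ∧ l ≠ j) = ({i, j} : Finset (Fin m))ᶜ := by
      ext l; simp
    have h4 := Finset.card_add_card_compl ({i, j} : Finset (Fin m))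
    rw [Finset.card_pair hij, Fintype.card_fin] at h4
    rw [h3]
    omega
  · intro a b hab
    simpa using hab

/-- With `k + 1` edges there are at least `m - 1` components, and the `m - 1` external vertices
other than `i` meet all of them; so each component contains exactly one. -/
lemma eq_of_connectedComponentMk_eq (G : FeynmanGraph m k N) {F : Finset (Fin N)}
    (hF : F.card = k + 1) {i : Fin m} (h : G.Covers F (Sum.inl '' {i}ᶜ)) {l l' : Fin m}
    (hl : l ≠ i) (hl' : l' ≠ i) (hll : (G.edgeGraph F).connectedComponentMk (Sum.inl l) =
      (G.edgeGraph F).connectedComponentMk (Sum.inl l')) : l = l' := by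
  have hs : Function.Surjective fun l : {l : Fin m // l ≠ i} =>
      (G.edgeGraph F).connectedComponentMk (Sum.inl l) := by
    intro C
    obtain ⟨v, ⟨l, hl, rfl⟩, hv⟩ := h C
    exact ⟨⟨l, hl⟩, hv⟩
  have h1 : Nat.card {l : Fin m // l ≠ i} = m - 1 := by simp
  have h2 := Nat.card_le_card_of_surjective _ hs
  have h3 := G.card_le_card_add_connectedComponent F
  have h4 : 0 < m := i.pos
  have hb := (Nat.bijective_iff_surjective_and_card _).2 ⟨hs, by omega⟩
  simpa using @hb.1 ⟨l, hl⟩ ⟨l', hl'⟩ hll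

/-- Some external `l ≠ i` shares the component of `i`. If `l ≠ j`, then `i` and `l` would be two
vertices other than `j` in one component. -/
lemma connectedComponentMk_eq_of_covers (G : FeynmanGraph m k N) {F : Finset (Fin N)}
    (hF : F.card = k + 1) {i j : Fin m} (hij : i ≠ j) (hi : G.Covers F (Sum.inl '' {i}ᶜ))
    (hj : G.Covers F (Sum.inl '' {j}ᶜ)) : (G.edgeGraph F).connectedComponentMk (Sum.inl i) =
      (G.edgeGraph F).connectedComponentMk (Sum.inl j) := by
  obtain ⟨v, ⟨l, hl, rfl⟩, hv⟩ := hi ((G.edgeGraph F).connectedComponentMk (Sum.inl i))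
  by_cases hlj : l = j
  · rw [← hv, hlj]
  · exact absurd (G.eq_of_connectedComponentMk_eq hF hj hlj hij hv) hl

/-- The two covering conditions are the nonvanishing criteria for the minors in which column `i`,
respectively `j`, is added to the internal columns. -/
lemma isSpanningForest_pairPartition_iff (G : FeynmanGraph m k N) {i j : Fin m} (hij : i ≠ j)
    (F : Finset (Fin N)) : G.IsSpanningForest (pairPartition m k i j) F ↔
      F.card = k + 1 ∧ G.Covers F (Sum.inl '' {i}ᶜ) ∧ G.Covers F (Sum.inl '' {j}ᶜ) := by
  have hcard := card_pairPartition (k := k) hij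
  rw [isSpanningForest_iff_of_nonempty _ (by simp +contextual [pairPartition, eq_comm])]
  constructor
  · rintro ⟨h1, h2, h3⟩
    have hc : (G.edgeGraph F).connectedComponentMk (Sum.inl i) =
        (G.edgeGraph F).connectedComponentMk (Sum.inl j) :=
      h3 _ (Finset.mem_insert_self _ _) _ (by simp) _ (by simp)
    have hl : ∀ C, ∃ l : Fin m, (G.edgeGraph F).connectedComponentMk (Sum.inl l) = C := by
      intro C
      obtain ⟨v, ⟨s, hs, hv⟩, rfl⟩ := h2 C
      simp only [pairPartition, Finset.mem_insert, Finset.mem_image, Finset.mem_filter,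
        Finset.mem_univ, true_and] at hs
      rcases hs with rfl | ⟨l, -, rfl⟩
      · rcases Finset.mem_insert.1 hv with rfl | hv
        · exact ⟨i, rfl⟩
        · exact ⟨j, by rw [Finset.mem_singleton.1 hv]⟩
      · exact ⟨l, by rw [Finset.mem_singleton.1 hv]⟩
    refine ⟨by omega, fun C => ?_, fun C => ?_⟩
    · obtain ⟨l, rfl⟩ := hl C
      by_cases h : l = i
      · exact ⟨_, ⟨j, hij.symm, rfl⟩, by rw [h, hc]⟩
      · exact ⟨_, ⟨l, h, rfl⟩, rfl⟩
    · obtain ⟨l, rfl⟩ := hl C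
      by_cases h : l = j
      · exact ⟨_, ⟨i, hij, rfl⟩, by rw [h, hc]⟩
      · exact ⟨_, ⟨l, h, rfl⟩, rfl⟩
  · rintro ⟨hF, hi, hj⟩
    have hc := G.connectedComponentMk_eq_of_covers hF hij hi hj
    refine ⟨by omega, fun C => ?_, ?_⟩
    · obtain ⟨v, ⟨l, hl, rfl⟩, hv⟩ := hi C
      refine ⟨_, ?_, hv⟩
      by_cases hlj : l = j
      · exact ⟨{Sum.inl i, Sum.inl j}, by simp [pairPartition], by simp [hlj]⟩
      · exact ⟨{Sum.inl l}, Finset.mem_insert_of_mem (Finset.mem_image_of_mem _ (by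
          simpa using ⟨hl, hlj⟩)), by simp⟩
    · simp only [pairPartition, Finset.mem_insert, Finset.mem_image, Finset.mem_filter,
        Finset.mem_univ, true_and]
      rintro s (rfl | ⟨l, -, rfl⟩) u hu v hv
      · simp only [Finset.mem_insert, Finset.mem_singleton] at hu hv
        rcases hu with rfl | rfl <;> rcases hv with rfl | rfl <;> simp [hc]
      · simp only [Finset.mem_singleton] at hu hv
        rw [hu, hv]

/-- The determinant of the Dirichlet Laplacian on the internal vertices is `Ψ̃`. -/
theorem det_weightedGram_inc (G : FeynmanGraph m k N) (α : Fin N → ℝ) :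
    (weightedGram (fun e (v : Fin k) => G.inc ℝ e (Sum.inr v)) α).det = G.PsiDual α := by
  classical
  rw [det_weightedGram, PsiDual, dualForestPoly, Finset.sum_filter, Finset.sum_filter]
  refine Finset.sum_congr rfl fun F _ => ?_
  simp only [isSpanningForest_singletonPartition_iff, Fintype.card_fin]
  by_cases hF : F.card = k
  · have φ : Fin k ≃ F := (F.equivFinOfCardEq hF).symm
    have hinj : Function.Injective (Sum.inr : Fin k → Fin m ⊕ Fin k) := Sum.inr_injective
    have hr : (Set.range (Sum.inr : Fin k → Fin m ⊕ Fin k))ᶜ = Set.range Sum.inl := by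
      simp
    rw [det_weightedGram_indicator _ φ]
    by_cases hC : G.Covers F (Set.range Sum.inl)
    · have := G.det_inc_int_sq hinj φ (by rwa [hr])
      rw [if_pos hF, if_pos ⟨hF, hC⟩, ← G.det_inc_map, ← Int.cast_pow, this]
      simp
    · have := (G.det_inc_ne_zero_iff (R := ℝ) hinj φ).not.2 (by rwa [hr])
      rw [not_not] at this
      rw [if_pos hF, if_neg (fun h => hC h.2), this]
      simp
  · rw [if_neg hF, if_neg fun h => hF h.1]

/-- The incidence vector on the internal vertices, extended by an edge's value of the coboundary
of `ξ`. -/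
def borderedInc (G : FeynmanGraph m k N) (ξ : Fin m → ℝ) (e : Fin N) : Fin k ⊕ Unit → ℝ :=
  Sum.elim (fun v => G.inc ℝ e (Sum.inr v)) fun _ => ∑ l, ξ l * G.inc ℝ e (Sum.inl l)

lemma _root_.Matrix.det_sumElim_sum {ι κ R : Type*} [Fintype ι] [DecidableEq ι] [Fintype κ]
    [CommRing R] (f : ι ⊕ Unit → ι → R) (g : ι ⊕ Unit → κ → R) (ξ : κ → R) :
    (Matrix.of fun i => Sum.elim (f i) fun _ => ∑ l, ξ l * g i l).det =
      ∑ l, ξ l * (Matrix.of fun i => Sum.elim (f i) fun _ => g i l).det := by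
  -- With the other columns fixed, the determinant as a function of the last column is a component
  -- of Cramer's linear map.
  have key : ∀ b : ι ⊕ Unit → R, (Matrix.of fun i => Sum.elim (f i) fun _ => b i).det =
      Matrix.cramer (Matrix.of fun i => Sum.elim (f i) fun _ => 0) b (Sum.inr ()) := by
    intro b
    rw [Matrix.cramer_apply]
    congr 1
    ext i (j | j) <;> simp
  simp only [key]
  have : (fun i => ∑ l, ξ l * g i l) = ∑ l, ξ l • fun i => g i l := by
    ext i; simp
  rw [this, map_sum]
  simp

/-- In the full double sum the terms with `ξ i ^ 2` and `ξ j ^ 2` die because `a` sums to zero;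
symmetry and the vanishing diagonal then halve it. -/
lemma sq_sum_mul_eq_of_sum_eq_zero {ι : Type*} [Fintype ι] [LinearOrder ι] (a ξ : ι → ℝ)
    (h : ∑ i, a i = 0) :
    (∑ i, ξ i * a i) ^ 2 = ∑ i, ∑ j with i < j, (ξ i - ξ j) ^ 2 * -(a i * a j) := by
  have h1 : ∑ i, ∑ j, (ξ i - ξ j) ^ 2 * -(a i * a j) = 2 * (∑ i, ξ i * a i) ^ 2 := by
    have : ∀ i j, (ξ i - ξ j) ^ 2 * -(a i * a j) = 2 * (ξ i * a i) * (ξ j * a j) -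
        ξ i ^ 2 * a i * a j - a i * (ξ j ^ 2 * a j) := fun i j => by ring
    simp only [this, Finset.sum_sub_distrib, ← Finset.mul_sum, ← Finset.sum_mul, h]
    ring
  have h2 : ∑ i, ∑ j, (ξ i - ξ j) ^ 2 * -(a i * a j) =
      2 * ∑ i, ∑ j with i < j, (ξ i - ξ j) ^ 2 * -(a i * a j) := by
    have h3 : ∑ i, ∑ j with j < i, (ξ i - ξ j) ^ 2 * -(a i * a j) =
        ∑ i, ∑ j with i < j, (ξ i - ξ j) ^ 2 * -(a i * a j) := by
      simp only [Finset.sum_filter]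
      rw [Finset.sum_comm]
      refine Finset.sum_congr rfl fun i _ => Finset.sum_congr rfl fun j _ => ?_
      split_ifs <;> ring
    rw [two_mul]
    nth_rewrite 2 [← h3]
    rw [← Finset.sum_add_distrib]
    refine Finset.sum_congr rfl fun i _ => ?_
    simp only [Finset.sum_filter]
    rw [← Finset.sum_add_distrib]
    refine Finset.sum_congr rfl fun j _ => ?_
    rcases lt_trichotomy i j with hij | rfl | hij
    · simp [hij, hij.not_gt]
    · simp
    · simp [hij, hij.not_gt]
  linarith

/-- The determinant is `∑ ξ l * a l`, where `a l` is the incidence minor on the internal columns and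
column `l`. These minors are `0` or `±1` and sum to zero. If `a i` and `a j` are nonzero, all others
vanish, so `a j = -a i` and `-(a i * a j) = 1`. -/
lemma det_borderedInc_sq (G : FeynmanGraph m k N) (ξ : Fin m → ℝ) {F : Finset (Fin N)}
    (hF : F.card = k + 1) (φ : Fin k ⊕ Unit ≃ F) [DecidablePred fun i : Fin m =>
      G.Covers F (Sum.inl '' {i}ᶜ)] :
    (Matrix.of fun i => G.borderedInc ξ (φ i)).det ^ 2 = ∑ i, ∑ j with i < j, (ξ i - ξ j) ^ 2 *
      if G.Covers F (Sum.inl '' {i}ᶜ) ∧ G.Covers F (Sum.inl '' {j}ᶜ) then 1 else 0 := by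
  let c : Fin m → Fin k ⊕ Unit → Fin m ⊕ Fin k := fun l => Sum.elim Sum.inr fun _ => Sum.inl l
  have hc : ∀ l, Function.Injective (c l) := by
    rintro l (x | x) (y | y) h <;> simp_all [c]
  have hr : ∀ l, (Set.range (c l))ᶜ = Sum.inl '' {l}ᶜ := by
    intro l
    ext (x | x) <;> simp [c, eq_comm]
  let a : Fin m → ℤ := fun l => (Matrix.of fun i j => G.inc ℤ (φ i : Fin N) (c l j)).det
  have ha : ∀ (R : Type) [CommRing R] l, ((a l : ℤ) : R) = (Matrix.of fun i => Sum.elim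
      (fun v => G.inc R (φ i : Fin N) (Sum.inr v)) fun _ => G.inc R (φ i : Fin N) (Sum.inl l)).det := by
    intro R _ l
    rw [G.det_inc_map]
    congr 1
    ext i (j | j) <;> rfl
  have ha0 : ∀ l, a l ≠ 0 ↔ G.Covers F (Sum.inl '' {l}ᶜ) := fun l => by
    rw [← hr]; exact G.det_inc_ne_zero_iff (hc l) φ
  -- The sum of the minors is the determinant whose last column is the sum of the external columns.
  -- Incidence rows sum to zero, so the all-ones vector lies in its kernel.
  have hsum : ∑ l, a l = 0 := by
    have h1 := Matrix.det_sumElim_sum (fun i (v : Fin k) => G.inc ℤ (φ i : Fin N) (Sum.inr v))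
      (fun i (l : Fin m) => G.inc ℤ (φ i : Fin N) (Sum.inl l)) 1
    simp only [Pi.one_apply, one_mul, ← ha ℤ, Int.cast_id] at h1
    rw [← h1, ← Matrix.exists_mulVec_eq_zero_iff]
    refine ⟨1, one_ne_zero, ?_⟩
    ext i
    have h2 := G.sum_inc_mul (φ i : Fin N) (1 : Fin m ⊕ Fin k → ℤ)
    simp only [Pi.one_apply, mul_one, sub_self, Fintype.sum_sum_type] at h2
    simpa [Matrix.mulVec, dotProduct, add_comm] using h2
  have hdet : (Matrix.of fun i => G.borderedInc ξ (φ i)).det = ∑ l, ξ l * (a l : ℝ) := by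
    simp only [ha ℝ]
    exact Matrix.det_sumElim_sum (fun i (v : Fin k) => G.inc ℝ (φ i : Fin N) (Sum.inr v))
      (fun i (l : Fin m) => G.inc ℝ (φ i : Fin N) (Sum.inl l)) ξ
  rw [hdet, sq_sum_mul_eq_of_sum_eq_zero _ _ (by exact_mod_cast hsum)]
  refine Finset.sum_congr rfl fun i _ => Finset.sum_congr rfl fun j hj => ?_
  have hij : i ≠ j := (Finset.mem_filter.1 hj).2.ne
  congr 1
  split_ifs with h
  · have hother : ∀ l, l ∉ ({i, j} : Finset (Fin m)) → a l = 0 := by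
      intro l hl
      simp only [Finset.mem_insert, Finset.mem_singleton, not_or] at hl
      by_contra hne
      have hl' := (ha0 l).1 hne
      have h1 := G.connectedComponentMk_eq_of_covers hF hij h.1 h.2
      have h2 := G.connectedComponentMk_eq_of_covers hF (Ne.symm hl.1) h.1 hl'
      exact hl.2 (G.eq_of_connectedComponentMk_eq hF h.1 hl.1 hij.symm (h2.symm.trans h1))
    rw [← Finset.sum_subset (Finset.subset_univ {i, j}) fun l _ hl => hother l hl,
      Finset.sum_pair hij] at hsum
    have hsq : a i ^ 2 = 1 := G.det_inc_int_sq (hc i) φ (by rw [hr]; exact h.1)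
    have : -(a i * a j) = 1 := by
      rw [← hsq]; linear_combination (-a i) * hsum
    exact_mod_cast this
  · rw [not_and_or, ← ha0, ← ha0, not_not, not_not] at h
    rcases h with h | h <;> simp [h]

/-- The bordered Laplacian determinant is the analogue of `Φ̃` for external data `ξ` in `ℝ`. -/
theorem det_weightedGram_borderedInc (G : FeynmanGraph m k N) (ξ : Fin m → ℝ) (α : Fin N → ℝ) :
    (weightedGram (G.borderedInc ξ) α).det = ∑ i, ∑ j with i < j,
      (ξ i - ξ j) ^ 2 * G.dualForestPoly (pairPartition m k i j) α := by
  classical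
  have h1 : ∀ i : Fin m, ∀ j ∈ Finset.univ.filter fun j => i < j,
      (ξ i - ξ j) ^ 2 * G.dualForestPoly (pairPartition m k i j) α =
      ∑ F : Finset (Fin N), (ξ i - ξ j) ^ 2 * if F.card = k + 1 ∧
        G.Covers F (Sum.inl '' {i}ᶜ) ∧ G.Covers F (Sum.inl '' {j}ᶜ) then ∏ e ∈ F, α e else 0 := by
    intro i j hj
    have hij : i ≠ j := (Finset.mem_filter.1 hj).2.ne
    rw [dualForestPoly, Finset.sum_filter, Finset.mul_sum]
    simp only [G.isSpanningForest_pairPartition_iff hij]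
  rw [Finset.sum_congr rfl fun i _ => Finset.sum_congr rfl (h1 i)]
  simp only [Finset.sum_comm (t := (Finset.univ : Finset (Finset (Fin N))))]
  rw [det_weightedGram, Finset.sum_filter]
  refine Finset.sum_congr rfl fun F _ => ?_
  simp only [Fintype.card_sum, Fintype.card_fin, Fintype.card_unit]
  split_ifs with hF
  · have φ : Fin k ⊕ Unit ≃ F := Fintype.equivOfCardEq (by simp [hF])
    rw [det_weightedGram_indicator _ φ, G.det_borderedInc_sq ξ hF φ, Finset.mul_sum]
    refine Finset.sum_congr rfl fun i _ => ?_
    rw [Finset.mul_sum]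
    refine Finset.sum_congr rfl fun j _ => ?_
    simp only [hF, true_and]
    split_ifs <;> ring
  · simp [hF]

end FeynmanGraph

/-! ### Gaussian integrals -/

section Gaussian

variable {ι κ : Type*} [Fintype ι] [Fintype κ]

/-- Transposition is a linear isomorphism, so the image measure is a multiple of Haar measure; the
unit cube is mapped to the unit cube, so the multiple is `1`. -/
lemma measurePreserving_pi_swap (ι κ : Type*) [Fintype ι] [Fintype κ] :
    MeasurePreserving (fun (f : ι → κ → ℝ) j i => f i j) := by
  let L : (ι → κ → ℝ) ≃ₗ[ℝ] (κ → ι → ℝ) :=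
    { toFun := fun f j i => f i j
      invFun := fun f i j => f j i
      map_add' := fun _ _ => rfl
      map_smul' := fun _ _ => rfl
      left_inv := fun _ => rfl
      right_inv := fun _ => rfl }
  have hL : MeasurePreserving L.toContinuousLinearEquiv := by
    refine ⟨L.toContinuousLinearEquiv.continuous.measurable, ?_⟩
    have := Measure.pi.isAddHaarMeasure fun _ : ι => (volume : Measure (κ → ℝ))
    rw [← volume_pi] at this
    have := L.toContinuousLinearEquiv.isAddHaarMeasure_map (volume : Measure (ι → κ → ℝ))
    have := Measure.pi.isAddHaarMeasure fun _ : κ => (volume : Measure (ι → ℝ))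
    rw [← volume_pi] at this
    have h := Measure.isAddLeftInvariant_eq_smul
      ((volume : Measure (ι → κ → ℝ)).map L.toContinuousLinearEquiv) volume
    have h1 := congrArg (fun μ => μ (Set.univ.pi fun _ => Set.univ.pi fun _ => Set.Ioc (0 : ℝ) 1)) h
    have h2 : L.toContinuousLinearEquiv ⁻¹' (Set.univ.pi fun _ => Set.univ.pi fun _ =>
        Set.Ioc (0 : ℝ) 1) = (Set.univ.pi fun _ => Set.univ.pi fun _ => Set.Ioc (0 : ℝ) 1) := by
      ext f
      simp only [Set.mem_preimage, Set.mem_univ_pi]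
      exact forall_comm
    have h3 : MeasurableSet (Set.univ.pi fun _ : κ => Set.univ.pi fun _ : ι =>
        Set.Ioc (0 : ℝ) 1) :=
      MeasurableSet.univ_pi fun _ => MeasurableSet.univ_pi fun _ => measurableSet_Ioc
    simp only [Measure.smul_apply] at h1
    rw [Measure.map_apply L.toContinuousLinearEquiv.continuous.measurable h3, h2] at h1
    simp only [volume_pi_pi, Real.volume_Ioc, sub_zero, ENNReal.ofReal_one, Finset.prod_const_one,
      ENNReal.smul_def, smul_eq_mul, mul_one] at h1
    rw [h]
    have h4 : Measure.addHaarScalarFactor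
        ((volume : Measure (ι → κ → ℝ)).map L.toContinuousLinearEquiv) volume = 1 := by
      exact_mod_cast h1.symm
    rw [h4, one_smul]
  exact hL

lemma integral_exp_neg_sq_mulVec [DecidableEq ι] {B : Matrix ι ι ℝ} (hB : B.det ≠ 0) (h : ι → ℝ) :
    Integrable (fun z : ι → ℝ => Real.exp (-∑ i, (B.mulVec (z + h)) i ^ 2)) ∧
      ∫ z : ι → ℝ, Real.exp (-∑ i, (B.mulVec (z + h)) i ^ 2) =
        √Real.pi ^ Fintype.card ι / |B.det| := by
  have h1 : ∀ w : ι → ℝ, Real.exp (-∑ i, w i ^ 2) = ∏ i, Real.exp (-1 * w i ^ 2) := fun w => by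
    rw [← Real.exp_sum]; simp
  have hi : Integrable fun w : ι → ℝ => Real.exp (-∑ i, w i ^ 2) := by
    simp only [h1]
    exact Integrable.fintype_prod fun _ => integrable_exp_neg_mul_sq one_pos
  have hv : ∫ w : ι → ℝ, Real.exp (-∑ i, w i ^ 2) = √Real.pi ^ Fintype.card ι := by
    simp only [h1]
    rw [integral_fintype_prod_volume_eq_pow (fun t : ℝ => Real.exp (-1 * t ^ 2)),
      integral_gaussian, div_one]
  have hmap := Real.map_matrix_volume_pi_eq_smul_volume_pi hB
  have hmeas : Measurable (Matrix.toLin' B) :=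
    (Matrix.toLin' B).continuous_of_finiteDimensional.measurable
  have hi' : Integrable (fun w : ι → ℝ => Real.exp (-∑ i, w i ^ 2))
      (volume.map (Matrix.toLin' B)) := by
    rw [hmap]
    exact hi.smul_measure ENNReal.ofReal_ne_top
  constructor
  · have := ((integrable_map_measure hi'.aestronglyMeasurable hmeas.aemeasurable).1 hi')
    exact this.comp_add_right h
  · rw [integral_add_right_eq_self (fun z : ι → ℝ => Real.exp (-∑ i, (B.mulVec z) i ^ 2)) h]
    have := integral_map hmeas.aemeasurable hi'.aestronglyMeasurable
    rw [hmap, integral_smul_measure, hv, ENNReal.toReal_ofReal (abs_nonneg _)] at this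
    simp only [Matrix.toLin'_apply] at this
    rw [← this, abs_inv, smul_eq_mul, mul_comm, div_eq_mul_inv]

/-- The value at its minimum of `z ↦ ∑_e α_e (b_e · z + η_e)²`. -/
def minQuad [DecidableEq ι] (b : κ → ι → ℝ) (η α : κ → ℝ) : ℝ :=
  (weightedGram (fun e => Sum.elim (b e) fun _ : Unit => η e) α).det / (weightedGram b α).det

lemma weightedGram_dotProduct (b : κ → ι → ℝ) (α : κ → ℝ) (z : ι → ℝ) :
    z ⬝ᵥ (weightedGram b α).mulVec z = ∑ e, α e * (∑ v, b e v * z v) ^ 2 := by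
  simp only [dotProduct, Matrix.mulVec, weightedGram, Matrix.of_apply, sq, Finset.mul_sum,
    Finset.sum_mul]
  simp only [Finset.sum_comm (s := (Finset.univ : Finset ι)) (t := (Finset.univ : Finset κ))]
  refine Finset.sum_congr rfl fun e _ => ?_
  rw [Finset.sum_comm]
  refine Finset.sum_congr rfl fun i _ => Finset.sum_congr rfl fun j _ => by ring

lemma posSemidef_weightedGram (b : κ → ι → ℝ) {α : κ → ℝ} (hα : ∀ e, 0 ≤ α e) :
    (weightedGram b α).PosSemidef := by
  refine Matrix.PosSemidef.of_dotProduct_mulVec_nonneg ?_ fun z => ?_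
  · ext i j
    simp only [weightedGram, Matrix.conjTranspose_apply, Matrix.of_apply, star_trivial]
    exact Finset.sum_congr rfl fun e _ => by ring
  · rw [star_trivial, weightedGram_dotProduct]
    exact Finset.sum_nonneg fun e _ => mul_nonneg (hα e) (sq_nonneg _)

/-- Completing the square. The remaining constant is the Schur complement of the Gram matrix in the
bordered one, hence the quotient of determinants in `minQuad`. -/
lemma exists_sum_sq_eq_add_minQuad [DecidableEq ι] (b : κ → ι → ℝ) (η α : κ → ℝ)
    (hdet : (weightedGram b α).det ≠ 0) : ∃ h : ι → ℝ, ∀ z : ι → ℝ,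
      ∑ e, α e * (∑ v, b e v * z v + η e) ^ 2 =
        (z + h) ⬝ᵥ (weightedGram b α).mulVec (z + h) + minQuad b η α := by
  set L := weightedGram b α with hL
  have hu : IsUnit L.det := isUnit_iff_ne_zero.2 hdet
  let _ : Invertible L := L.invertibleOfIsUnitDet hu
  let c : ι → ℝ := fun v => ∑ e, α e * η e * b e v
  let q : ℝ := ∑ e, α e * η e ^ 2
  have hLT : L.transpose = L := by
    ext i j
    simp only [hL, weightedGram, Matrix.transpose_apply, Matrix.of_apply]
    exact Finset.sum_congr rfl fun e _ => by ring
  have hblock : weightedGram (fun e => Sum.elim (b e) fun _ : Unit => η e) α =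
      Matrix.fromBlocks L (Matrix.replicateCol Unit c) (Matrix.replicateRow Unit c)
        (Matrix.of fun _ _ => q) := by
    ext (i | i) (j | j)
    · rfl
    · simp [weightedGram, c]
      exact Finset.sum_congr rfl fun e _ => by ring
    · simp [weightedGram, c]
    · simp [weightedGram, q, sq, mul_assoc]
  have hmin : minQuad b η α = q - c ⬝ᵥ L⁻¹.mulVec c := by
    rw [minQuad, hblock, Matrix.det_fromBlocks₁₁, ← hL, mul_div_cancel_left₀ _ hdet,
      Matrix.invOf_eq_nonsing_inv, Matrix.det_unique]
    simp only [Matrix.sub_apply, Matrix.of_apply, Matrix.mul_assoc]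
    congr 1
  refine ⟨L⁻¹.mulVec c, fun z => ?_⟩
  have h1 : L.mulVec (L⁻¹.mulVec c) = c := by
    rw [Matrix.mulVec_mulVec, Matrix.mul_nonsing_inv _ hu, Matrix.one_mulVec]
  have h2 : L⁻¹.mulVec c ⬝ᵥ L.mulVec z = c ⬝ᵥ z := by
    rw [Matrix.dotProduct_mulVec, ← Matrix.mulVec_transpose, hLT, h1]
  have h3 : ∑ e, α e * (∑ v, b e v * z v + η e) ^ 2 =
      z ⬝ᵥ L.mulVec z + 2 * (c ⬝ᵥ z) + q := by
    have h4 : c ⬝ᵥ z = ∑ e, α e * η e * ∑ v, b e v * z v := by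
      simp only [c, dotProduct, Finset.sum_mul, Finset.mul_sum]
      rw [Finset.sum_comm]
      exact Finset.sum_congr rfl fun e _ => Finset.sum_congr rfl fun v _ => by ring
    rw [hL, weightedGram_dotProduct, h4, Finset.mul_sum, ← Finset.sum_add_distrib,
      ← Finset.sum_add_distrib]
    exact Finset.sum_congr rfl fun e _ => by ring
  rw [h3, hmin, Matrix.mulVec_add, h1, add_dotProduct, dotProduct_add, dotProduct_add, h2,
    dotProduct_comm z c, dotProduct_comm (L⁻¹.mulVec c) c]
  ring

lemma integral_exp_neg_sum_sq [DecidableEq ι] (b : κ → ι → ℝ) (η : κ → ℝ) {α : κ → ℝ} (hα : ∀ e, 0 ≤ α e)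
    (hdet : (weightedGram b α).det ≠ 0) :
    Integrable (fun z : ι → ℝ => Real.exp (-∑ e, α e * (∑ v, b e v * z v + η e) ^ 2)) ∧
      ∫ z : ι → ℝ, Real.exp (-∑ e, α e * (∑ v, b e v * z v + η e) ^ 2) =
        √Real.pi ^ Fintype.card ι / √(weightedGram b α).det * Real.exp (-minQuad b η α) := by
  obtain ⟨h, hh⟩ := exists_sum_sq_eq_add_minQuad b η α hdet
  -- A square root factorization reduces the integral to a standard Gaussian; `|B.det|` is the
  -- square root of the Gram determinant.
  obtain ⟨B, hB⟩ : ∃ B : Matrix ι ι ℝ, weightedGram b α = B.transpose * B := by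
    open scoped MatrixOrder in
    obtain ⟨B, hB⟩ := CStarAlgebra.nonneg_iff_eq_star_mul_self.mp
      (posSemidef_weightedGram b hα).nonneg
    exact ⟨B, by rw [hB, Matrix.star_eq_conjTranspose, Matrix.conjTranspose_eq_transpose_of_trivial]⟩
  have hBdet : (weightedGram b α).det = B.det ^ 2 := by
    rw [hB, Matrix.det_mul, Matrix.det_transpose, sq]
  have hB0 : B.det ≠ 0 := fun h0 => hdet (by rw [hBdet, h0]; simp)
  have h1 : ∀ z : ι → ℝ, Real.exp (-∑ e, α e * (∑ v, b e v * z v + η e) ^ 2) =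
      Real.exp (-∑ i, (B.mulVec (z + h)) i ^ 2) * Real.exp (-minQuad b η α) := by
    intro z
    rw [hh, hB, ← Matrix.mulVec_mulVec, Matrix.dotProduct_mulVec, Matrix.vecMul_transpose,
      neg_add, Real.exp_add]
    simp [dotProduct, sq]
  obtain ⟨hi, hv⟩ := integral_exp_neg_sq_mulVec hB0 h
  simp only [h1]
  refine ⟨hi.mul_const _, ?_⟩
  rw [integral_mul_const, hv, hBdet, Real.sqrt_sq_eq_abs]

end Gaussian

/-! ### The Gaussian integral of a graph in terms of `Ψ̃` and `Φ̃` -/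

namespace FeynmanGraph

variable {m k N d : ℕ}

lemma Q_eq (G : FeynmanGraph m k N) (y : Fin m ⊕ Fin k → EuclideanSpace ℝ (Fin d)) (e : Fin N) :
    G.Q y e = ‖y (G.src e) - y (G.tgt e)‖ ^ 2 := by
  rw [Q, ← mk_src_tgt]
  rfl

lemma Q_nonneg (G : FeynmanGraph m k N) (y : Fin m ⊕ Fin k → EuclideanSpace ℝ (Fin d))
    (e : Fin N) : 0 ≤ G.Q y e := by
  rw [Q_eq]; positivity

/-- The coboundary of the external data `ξ`. -/
def extInc (G : FeynmanGraph m k N) (ξ : Fin m → ℝ) (e : Fin N) : ℝ :=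
  ∑ l, ξ l * G.inc ℝ e (Sum.inl l)

lemma Q_eq_sum (G : FeynmanGraph m k N) (x : Fin m → EuclideanSpace ℝ (Fin d))
    (y : Fin k → EuclideanSpace ℝ (Fin d)) (e : Fin N) :
    G.Q (Sum.elim x y) e = ∑ a, (∑ v, G.inc ℝ e (Sum.inr v) * y v a +
      G.extInc (fun l => x l a) e) ^ 2 := by
  rw [Q_eq, EuclideanSpace.norm_sq_eq]
  refine Finset.sum_congr rfl fun a _ => ?_
  have h := G.sum_inc_mul e fun v => Sum.elim x y v a
  rw [Fintype.sum_sum_type] at h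
  rw [Real.norm_eq_abs, sq_abs, PiLp.sub_apply, ← h, extInc, add_comm]
  congr 2
  exact Finset.sum_congr rfl fun l _ => mul_comm _ _

/-- The minimum over the internal positions of `∑_e α_e Q_e` is `Φ̃ / Ψ̃`. -/
lemma sum_minQuad (G : FeynmanGraph m k N) (x : Fin m → EuclideanSpace ℝ (Fin d))
    (α : Fin N → ℝ) : ∑ a : Fin d, minQuad (fun e (v : Fin k) => G.inc ℝ e (Sum.inr v))
      (G.extInc fun l => x l a) α = G.PhiDual x α / G.PsiDual α := by
  simp only [minQuad, det_weightedGram_inc, ← Finset.sum_div]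
  congr 1
  have h : ∀ a : Fin d, (weightedGram (fun e => Sum.elim (fun v : Fin k => G.inc ℝ e (Sum.inr v))
      fun _ : Unit => G.extInc (fun l => x l a) e) α).det = _ :=
    fun a => G.det_weightedGram_borderedInc (fun l => x l a) α
  simp only [h, PhiDual, EuclideanSpace.norm_sq_eq, Real.norm_eq_abs, sq_abs, PiLp.sub_apply,
    Finset.sum_mul]
  rw [Finset.sum_comm]
  exact Finset.sum_congr rfl fun i _ => Finset.sum_comm

/-- The coordinates of the internal positions, as an identification preserving the measure. -/
lemma measurePreserving_coordinates (k d : ℕ) : MeasurePreserving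
    (fun (w : Fin d → Fin k → ℝ) (v : Fin k) =>
      (WithLp.toLp 2 fun a => w a v : EuclideanSpace ℝ (Fin d))) :=
  (volume_preserving_pi fun _ : Fin k =>
    PiLp.volume_preserving_toLp (Fin d)).comp (measurePreserving_pi_swap (Fin d) (Fin k))

/-- The Gaussian integral over the internal positions. -/
theorem integral_exp_neg_sum_Q (G : FeynmanGraph m k N) (x : Fin m → EuclideanSpace ℝ (Fin d))
    {α : Fin N → ℝ} (hα : ∀ e, 0 ≤ α e) (hΨ : G.PsiDual α ≠ 0) :
    Integrable (fun y : Fin k → EuclideanSpace ℝ (Fin d) =>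
      Real.exp (-∑ e, α e * G.Q (Sum.elim x y) e)) ∧
    ∫ y : Fin k → EuclideanSpace ℝ (Fin d), Real.exp (-∑ e, α e * G.Q (Sum.elim x y) e) =
      (√Real.pi ^ k / √(G.PsiDual α)) ^ d * Real.exp (-(G.PhiDual x α / G.PsiDual α)) := by
  have hmp := measurePreserving_coordinates k d
  have hemb : MeasurableEmbedding (fun (w : Fin d → Fin k → ℝ) (v : Fin k) =>
      (WithLp.toLp 2 fun a => w a v : EuclideanSpace ℝ (Fin d))) := by
    refine hmp.measurable.measurableEmbedding fun w w' h => ?_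
    ext a v
    exact congrArg (fun y => y v a) h
  have hdet := G.det_weightedGram_inc α
  have hg := fun a : Fin d => integral_exp_neg_sum_sq
    (fun e (v : Fin k) => G.inc ℝ e (Sum.inr v)) (G.extInc fun l => x l a) hα (hdet ▸ hΨ)
  -- Since `Q_e` is a sum over coordinates, the integral factors into `d` Gaussians with the same
  -- matrix and different shifts.
  have hexp : ∀ w : Fin d → Fin k → ℝ,
      Real.exp (-∑ e, α e * G.Q (Sum.elim x fun v => WithLp.toLp 2 fun a => w a v) e) =
      ∏ a, Real.exp (-∑ e, α e * (∑ v, G.inc ℝ e (Sum.inr v) * w a v +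
        G.extInc (fun l => x l a) e) ^ 2) := by
    intro w
    rw [← Real.exp_sum, Finset.sum_neg_distrib, Finset.sum_comm]
    simp only [Q_eq_sum, Finset.mul_sum]
  rw [← hmp.integrable_comp_emb hemb, ← hmp.integral_comp hemb]
  simp only [Function.comp_def, hexp]
  refine ⟨Integrable.fintype_prod_dep fun a => (hg a).1, ?_⟩
  rw [integral_fintype_prod_volume_eq_prod (fun a (z : Fin k → ℝ) => Real.exp (-∑ e, α e *
    (∑ v, G.inc ℝ e (Sum.inr v) * z v + G.extInc (fun l => x l a) e) ^ 2))]
  simp only [fun a => (hg a).2, hdet, Fintype.card_fin]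
  rw [Finset.prod_mul_distrib, ← Real.exp_sum, Finset.sum_neg_distrib, sum_minQuad,
    Finset.prod_const, Finset.card_univ, Fintype.card_fin]

end FeynmanGraph

/-! ### Iterated partial derivatives on the positive orthant -/

section Derivatives

variable {N : ℕ}

/-- The positive orthant. -/
def orthant (ι : Type*) : Set (ι → ℝ) := {α | ∀ e, 0 < α e}

lemma isOpen_orthant (ι : Type*) [Finite ι] : IsOpen (orthant ι) := by
  have : orthant ι = Set.univ.pi fun _ => Set.Ioi 0 := by
    ext α; simp [orthant]
  rw [this]
  exact isOpen_set_pi Set.finite_univ fun _ _ => isOpen_Ioi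

lemma smul_mem_orthant {ι : Type*} {t : ℝ} (ht : 0 < t) {α : ι → ℝ} (hα : α ∈ orthant ι) :
    t • α ∈ orthant ι := fun e => mul_pos ht (hα e)

/-- The partial derivatives with respect to the variables in a list. -/
def listDeriv (l : List (Fin N)) (f : (Fin N → ℝ) → ℝ) : (Fin N → ℝ) → ℝ :=
  l.foldr partialDeriv f

lemma listDeriv_cons (e : Fin N) (l : List (Fin N)) (f : (Fin N → ℝ) → ℝ) :
    listDeriv (e :: l) f = partialDeriv e (listDeriv l f) := rfl

/-- The list containing each `e` with multiplicity `n e`. -/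
def multiplicityList (n : Fin N → ℕ) : List (Fin N) :=
  (List.finRange N).flatMap fun e => List.replicate (n e) e

lemma multiPartialDeriv_eq_listDeriv (n : Fin N → ℕ) (f : (Fin N → ℝ) → ℝ) :
    multiPartialDeriv n f = listDeriv (multiplicityList n) f := by
  rw [multiPartialDeriv, multiplicityList]
  induction List.finRange N with
  | nil => rfl
  | cons e l ih =>
    rw [List.foldr_cons, ih, listDeriv, listDeriv, List.flatMap_cons, List.foldr_append]
    generalize List.foldr partialDeriv f (List.flatMap (fun e => List.replicate (n e) e) l) = g
    induction n e with
    | zero => rfl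
    | succ i ihi =>
      rw [Function.iterate_succ_apply', ihi, List.replicate_succ, List.foldr_cons]

lemma prod_map_multiplicityList (n : Fin N → ℕ) (q : Fin N → ℝ) :
    ((multiplicityList n).map q).prod = ∏ e, q e ^ n e := by
  rw [multiplicityList, Fin.prod_univ_def]
  induction List.finRange N with
  | nil => simp
  | cons e l ih =>
    rw [List.flatMap_cons, List.map_append, List.prod_append, ih, List.map_replicate,
      List.prod_replicate, List.map_cons, List.prod_cons]

lemma length_multiplicityList (n : Fin N → ℕ) : (multiplicityList n).length = ∑ e, n e := by
  rw [multiplicityList, List.length_flatMap, Fin.sum_univ_def]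
  simp

lemma partialDeriv_congr {U : Set (Fin N → ℝ)} (hU : IsOpen U) {f g : (Fin N → ℝ) → ℝ}
    (h : Set.EqOn f g U) (e : Fin N) : Set.EqOn (partialDeriv e f) (partialDeriv e g) U :=
  fun _ hα => (h.eventuallyEq_of_mem (hU.mem_nhds hα)).lineDeriv_eq

lemma listDeriv_congr {U : Set (Fin N → ℝ)} (hU : IsOpen U) {f g : (Fin N → ℝ) → ℝ}
    (h : Set.EqOn f g U) (l : List (Fin N)) : Set.EqOn (listDeriv l f) (listDeriv l g) U := by
  induction l with
  | nil => exact h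
  | cons e l ih => exact partialDeriv_congr hU ih e

lemma partialDeriv_const_mul (c : ℝ) (f : (Fin N → ℝ) → ℝ) (e : Fin N) :
    partialDeriv e (fun α => c * f α) = fun α => c * partialDeriv e f α := by
  ext α
  simp only [partialDeriv, lineDeriv]
  exact deriv_const_mul_field c

lemma listDeriv_const_mul (c : ℝ) (f : (Fin N → ℝ) → ℝ) (l : List (Fin N)) :
    listDeriv l (fun α => c * f α) = fun α => c * listDeriv l f α := by
  induction l with
  | nil => rfl
  | cons e l ih => rw [listDeriv_cons, ih, partialDeriv_const_mul, listDeriv_cons]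

lemma partialDeriv_comp_smul (t : ℝ) (f : (Fin N → ℝ) → ℝ) (e : Fin N) (α : Fin N → ℝ) :
    partialDeriv e (fun β => f (t • β)) α = t * partialDeriv e f (t • α) := by
  simp only [partialDeriv]
  rw [← smul_eq_mul, ← lineDeriv_smul]
  simp only [lineDeriv, smul_add, smul_comm t]

lemma partialDeriv_homogeneous {f : (Fin N → ℝ) → ℝ} {s : ℝ}
    (hf : ∀ t : ℝ, 0 < t → ∀ α ∈ orthant (Fin N), f (t • α) = t ^ s * f α) (e : Fin N) :
    ∀ t : ℝ, 0 < t → ∀ α ∈ orthant (Fin N),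
      partialDeriv e f (t • α) = t ^ (s - 1) * partialDeriv e f α := by
  intro t ht α hα
  have h := partialDeriv_congr (isOpen_orthant _) (hf t ht) e hα
  rw [partialDeriv_comp_smul, partialDeriv_const_mul] at h
  rw [Real.rpow_sub_one ht.ne']
  field_simp
  linarith

lemma listDeriv_homogeneous {f : (Fin N → ℝ) → ℝ} {s : ℝ}
    (hf : ∀ t : ℝ, 0 < t → ∀ α ∈ orthant (Fin N), f (t • α) = t ^ s * f α) (l : List (Fin N)) :
    ∀ t : ℝ, 0 < t → ∀ α ∈ orthant (Fin N),
      listDeriv l f (t • α) = t ^ (s - l.length) * listDeriv l f α := by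
  induction l with
  | nil => simpa [listDeriv] using hf
  | cons e l ih =>
    intro t ht α hα
    rw [listDeriv_cons, partialDeriv_homogeneous ih e t ht α hα, List.length_cons]
    push_cast
    ring_nf

lemma partialDeriv_eq_fderiv {f : (Fin N → ℝ) → ℝ} {α : Fin N → ℝ} (h : DifferentiableAt ℝ f α)
    (e : Fin N) : partialDeriv e f α = fderiv ℝ f α (Pi.single e 1) :=
  h.lineDeriv_eq_fderiv

open scoped ContDiff in
lemma contDiffOn_partialDeriv {U : Set (Fin N → ℝ)} (hU : IsOpen U) {f : (Fin N → ℝ) → ℝ}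
    (hf : ContDiffOn ℝ ∞ f U) (e : Fin N) : ContDiffOn ℝ ∞ (partialDeriv e f) U := by
  refine ((hf.fderiv_of_isOpen hU (m := ∞) (by simp)).clm_apply
    (contDiffOn_const (c := Pi.single e 1))).congr fun α hα => ?_
  exact partialDeriv_eq_fderiv ((hf.differentiableOn (by simp)).differentiableAt (hU.mem_nhds hα)) e

open scoped ContDiff in
/-- Iterated partial derivatives of `w φ₀(u)` for a sequence of functions with `φ_j' = -φ_{j+1}`:
the coefficients do not depend on the sequence. -/
lemma exists_listDeriv_eq_sum {U : Set (Fin N → ℝ)} (hU : IsOpen U) {w u : (Fin N → ℝ) → ℝ}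
    (hw : ContDiffOn ℝ ∞ w U) (hu : ContDiffOn ℝ ∞ u U) (hpos : ∀ α ∈ U, 0 < u α)
    (l : List (Fin N)) : ∃ g : ℕ → (Fin N → ℝ) → ℝ, (∀ j, ContDiffOn ℝ ∞ (g j) U) ∧
      (∀ j, l.length < j → g j = 0) ∧
      ∀ φ : ℕ → ℝ → ℝ, (∀ j, ∀ r : ℝ, 0 < r → HasDerivAt (φ j) (-φ (j + 1) r) r) →
        ∀ α ∈ U, listDeriv l (fun β => w β * φ 0 (u β)) α =
          ∑ j ∈ Finset.range (l.length + 1), g j α * φ j (u α) := by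
  induction l with
  | nil =>
    refine ⟨fun j => if j = 0 then w else 0, fun j => ?_, fun j hj => ?_, fun φ _ α _ => ?_⟩
    · dsimp only
      split_ifs
      · exact hw
      · exact contDiffOn_const
    · simp only [List.length_nil] at hj
      simp [hj.ne']
    · simp [listDeriv]
  | cons e l ih =>
    obtain ⟨g, hg, hg0, hgφ⟩ := ih
    -- By the product rule and `φ_j' = -φ_(j+1)`, the new coefficient of `φ_j` is `∂g_j - g_(j-1)
    -- ∂u`, without the second term for `j = 0`.
    obtain ⟨g', hg'0, hg's⟩ : ∃ g' : ℕ → (Fin N → ℝ) → ℝ, g' 0 = partialDeriv e (g 0) ∧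
        ∀ i, g' (i + 1) = fun α => partialDeriv e (g (i + 1)) α - g i α * partialDeriv e u α :=
      ⟨fun j => Nat.casesOn j (partialDeriv e (g 0))
        fun i α => partialDeriv e (g (i + 1)) α - g i α * partialDeriv e u α, rfl, fun _ => rfl⟩
    refine ⟨g', ?_, ?_, ?_⟩
    · rintro (_ | i)
      · exact hg'0 ▸ contDiffOn_partialDeriv hU (hg 0) e
      · rw [hg's]
        exact (contDiffOn_partialDeriv hU (hg _) e).sub
          ((hg i).mul (contDiffOn_partialDeriv hU hu e))
    · rintro (_ | i) hi
      · simp at hi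
      · have h0 : partialDeriv e (0 : (Fin N → ℝ) → ℝ) = 0 := by
          ext α; simp [partialDeriv, lineDeriv]
        simp only [List.length_cons, Nat.add_lt_add_iff_right] at hi
        ext α
        simp [hg's, hg0 i hi, hg0 (i + 1) (by omega), h0]
    · intro φ hφ α hα
      have hda : ∀ {f : (Fin N → ℝ) → ℝ}, ContDiffOn ℝ ∞ f U → DifferentiableAt ℝ f α :=
        fun hf => (hf.differentiableOn (by simp)).differentiableAt (hU.mem_nhds hα)
      have h0 : partialDeriv e (g (l.length + 1)) α = 0 := by
        rw [hg0 _ (Nat.lt_succ_self _)]; simp [partialDeriv, lineDeriv]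
      rw [listDeriv_cons, partialDeriv_congr hU (hgφ φ hφ) e hα]
      have hj : ∀ j, HasFDerivAt (fun β => g j β * φ j (u β))
          (g j α • (-φ (j + 1) (u α)) • fderiv ℝ u α + φ j (u α) • fderiv ℝ (g j) α) α := by
        intro j
        exact (hda (hg j)).hasFDerivAt.mul
          ((hφ j (u α) (hpos α hα)).comp_hasFDerivAt α (hda hu).hasFDerivAt)
      have hsum := HasFDerivAt.fun_sum fun j (_ : j ∈ Finset.range (l.length + 1)) => hj j
      rw [partialDeriv_eq_fderiv hsum.differentiableAt, hsum.fderiv]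
      simp only [sum_apply, add_apply, smul_apply, ← partialDeriv_eq_fderiv (hda (hg _)),
        ← partialDeriv_eq_fderiv (hda hu), smul_eq_mul, Finset.sum_add_distrib]
      rw [List.length_cons, Finset.sum_range_succ' fun j => g' j α * φ j (u α)]
      simp only [hg'0, hg's, sub_mul, Finset.sum_sub_distrib]
      rw [Finset.sum_range_succ (fun i => partialDeriv e (g (i + 1)) α * φ (i + 1) (u α)), h0,
        Finset.sum_range_succ' (fun i => φ i (u α) * partialDeriv e (g i) α)]
      have h1 : ∀ i, g i α * (-φ (i + 1) (u α) * partialDeriv e u α) =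
        -(g i α * partialDeriv e u α * φ (i + 1) (u α)) := fun i => by ring
      have h2 : ∀ i, φ i (u α) * partialDeriv e (g i) α = partialDeriv e (g i) α * φ i (u α) :=
        fun i => mul_comm _ _
      simp only [h1, h2, Finset.sum_neg_distrib]
      ring

/-- This family and the next both obey the recursion of `exists_listDeriv_eq_sum`. Against `t ^ (M -
1)`, the Mellin transform of this one is the next whenever `M + j > 0`. -/
lemma hasDerivAt_exp_kernel (t : ℝ) (j : ℕ) (r : ℝ) :
    HasDerivAt (fun r => t ^ j * Real.exp (-(t * r))) (-(t ^ (j + 1) * Real.exp (-(t * r)))) r := by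
  have h1 : HasDerivAt (fun r => -(t * r)) (-t) r := by
    simpa using ((hasDerivAt_id r).const_mul t).fun_neg
  convert! h1.exp.const_mul (t ^ j) using 1
  ring

/-- The equation `Γ(s + 1) = s Γ(s)` absorbs the exponent brought down. It needs only `s ≠ 0`, so
negative `M` is allowed. -/
lemma hasDerivAt_gamma_kernel {M : ℝ} (hM : ∀ j : ℕ, M ≠ -(j : ℝ)) (j : ℕ) {r : ℝ} (hr : 0 < r) :
    HasDerivAt (fun r => Real.Gamma (M + j) * r ^ (-(M + j)))
      (-(Real.Gamma (M + (j + 1 : ℕ)) * r ^ (-(M + (j + 1 : ℕ))))) r := by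
  have h := (Real.hasDerivAt_rpow_const (x := r) (p := -(M + j)) (Or.inl hr.ne')).const_mul
    (Real.Gamma (M + j))
  have hj : M + j ≠ 0 := fun h => hM j (by linarith)
  convert! h using 1
  rw [show M + ((j + 1 : ℕ) : ℝ) = M + j + 1 by push_cast; ring, Real.Gamma_add_one hj,
    show -(M + j) - 1 = -(M + j + 1) by ring]
  ring

/-! ### Differentiation under the integral sign -/

variable {Y : Type*} [MeasurableSpace Y] {μ : Measure Y}

lemma mul_exp_neg_mul_le {c : ℝ} (hc : 0 < c) (q : ℝ) : q * Real.exp (-(c * q)) ≤ 1 / c := by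
  have h1 := Real.add_one_le_exp (c * q)
  rw [Real.exp_neg, ← div_eq_mul_inv, div_le_div_iff₀ (Real.exp_pos _) hc]
  linarith

lemma sum_update_mul (α q : Fin N → ℝ) (e : Fin N) (c : ℝ) :
    ∑ i, Function.update α e c i * q i = ∑ i, α i * q i + (c - α e) * q e := by
  rw [← Finset.add_sum_erase _ _ (Finset.mem_univ e),
    ← Finset.add_sum_erase _ (fun i => α i * q i) (Finset.mem_univ e), Function.update_self,
    Finset.sum_congr rfl fun i hi => by rw [Function.update_of_ne (Finset.ne_of_mem_erase hi)]]
  ring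

lemma update_mem_orthant {α : Fin N → ℝ} (hα : α ∈ orthant (Fin N)) (e : Fin N) {c : ℝ}
    (hc : 0 < c) : Function.update α e c ∈ orthant (Fin N) := by
  intro i
  rcases eq_or_ne i e with rfl | h
  · simpa
  · rw [Function.update_of_ne h]; exact hα i

lemma prod_map_nonneg (q : Fin N → ℝ) (hq : ∀ e, 0 ≤ q e) (l : List (Fin N)) :
    0 ≤ (l.map q).prod :=
  List.prod_nonneg (by simpa using fun a _ => hq a)

lemma measurable_prod_map {q : Fin N → Y → ℝ} (hm : ∀ e, Measurable (q e)) (l : List (Fin N)) :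
    Measurable fun y => (l.map fun e => q e y).prod := by
  induction l with
  | nil => simp
  | cons e l ih =>
    simp only [List.map_cons, List.prod_cons]
    exact (hm e).mul ih

/-- Each factor `q e` is paid for by half of `α e`, because `q * exp(-α q / 2)` is bounded; the
other half remains for the induction. -/
lemma integrable_prod_mul_exp {q : Fin N → Y → ℝ} (hm : ∀ e, Measurable (q e))
    (hq : ∀ e y, 0 ≤ q e y)
    (hint : ∀ α ∈ orthant (Fin N), Integrable (fun y => Real.exp (-∑ e, α e * q e y)) μ)
    (l : List (Fin N)) : ∀ α ∈ orthant (Fin N),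
      Integrable (fun y => (l.map fun e => q e y).prod * Real.exp (-∑ e, α e * q e y)) μ := by
  induction l with
  | nil => simpa using hint
  | cons e l ih =>
    intro α hα
    have hc : 0 < α e / 2 := half_pos (hα e)
    refine ((ih _ (update_mem_orthant hα e hc)).const_mul (1 / (α e / 2))).mono' ?_ ?_
    · exact ((measurable_prod_map hm _).mul
        (Finset.measurable_fun_sum _ fun i _ => (hm i).const_mul _).neg.exp).aestronglyMeasurable
    · refine Filter.Eventually.of_forall fun y => ?_
      have h1 := mul_exp_neg_mul_le hc (q e y)
      have h2 := prod_map_nonneg (fun e => q e y) (fun e => hq e y) l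
      rw [Real.norm_of_nonneg (mul_nonneg (prod_map_nonneg _ (fun e => hq e y) _)
        (Real.exp_pos _).le), sum_update_mul α (fun e => q e y)]
      have h3 : Real.exp (-∑ i, α i * q i y) = Real.exp (-(α e / 2 * q e y)) *
          Real.exp (-(∑ i, α i * q i y + (α e / 2 - α e) * q e y)) := by
        rw [← Real.exp_add]; congr 1; ring
      rw [List.map_cons, List.prod_cons, h3]
      calc q e y * (l.map fun e => q e y).prod * (Real.exp (-(α e / 2 * q e y)) *
            Real.exp (-(∑ i, α i * q i y + (α e / 2 - α e) * q e y)))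
          = (q e y * Real.exp (-(α e / 2 * q e y))) * ((l.map fun e => q e y).prod *
            Real.exp (-(∑ i, α i * q i y + (α e / 2 - α e) * q e y))) := by ring
        _ ≤ _ := mul_le_mul_of_nonneg_right h1 (mul_nonneg h2 (Real.exp_pos _).le)

lemma listDeriv_integral_exp {q : Fin N → Y → ℝ} (hm : ∀ e, Measurable (q e))
    (hq : ∀ e y, 0 ≤ q e y)
    (hint : ∀ α ∈ orthant (Fin N), Integrable (fun y => Real.exp (-∑ e, α e * q e y)) μ)
    (l : List (Fin N)) : ∀ α ∈ orthant (Fin N),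
      listDeriv l (fun β => ∫ y, Real.exp (-∑ e, β e * q e y) ∂μ) α =
        (-1) ^ l.length *
          ∫ y, (l.map fun e => q e y).prod * Real.exp (-∑ e, α e * q e y) ∂μ := by
  have hmeas : ∀ (l : List (Fin N)) (β : Fin N → ℝ), AEStronglyMeasurable
      (fun y => (l.map fun e => q e y).prod * Real.exp (-∑ e, β e * q e y)) μ := fun l β =>
    ((measurable_prod_map hm l).mul
      (Finset.measurable_fun_sum _ fun i _ => (hm i).const_mul _).neg.exp).aestronglyMeasurable
  induction l with
  | nil => intro α _; simp [listDeriv]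
  | cons e l ih =>
    intro α hα
    rw [listDeriv_cons, partialDeriv_congr (isOpen_orthant _) ih e hα, partialDeriv_const_mul,
      List.length_cons, pow_succ, mul_assoc]
    have hc : 0 < α e / 2 := half_pos (hα e)
    have hline : ∀ (τ : ℝ) (y : Y), ∑ i, (α + τ • (Pi.single e 1 : Fin N → ℝ)) i * q i y =
        ∑ i, α i * q i y + τ * q e y := by
      intro τ y
      simp [add_mul, Finset.sum_add_distrib, Pi.single_apply]
    have hline' : ∀ (τ : ℝ) (y : Y), ∑ i, α i * q i y + τ * q e y =
        ∑ i, Function.update α e (α e + τ) i * q i y := by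
      intro τ y
      rw [sum_update_mul α (fun e => q e y)]
      ring
    -- For `|τ| < α e / 2` the weight of `q e` stays above `α e / 2`, which gives a dominating
    -- function independent of `τ`.
    have hbound : ∀ᵐ y ∂μ, ∀ τ ∈ Metric.ball (0 : ℝ) (α e / 2),
        ‖-(((e :: l).map fun e => q e y).prod *
          Real.exp (-(∑ i, α i * q i y + τ * q e y)))‖ ≤ ((e :: l).map fun e => q e y).prod *
            Real.exp (-∑ i, Function.update α e (α e / 2) i * q i y) := by
      refine Filter.Eventually.of_forall fun y τ hτ => ?_
      have h1 := prod_map_nonneg (fun e => q e y) (fun e => hq e y) (e :: l)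
      rw [norm_neg, Real.norm_of_nonneg (mul_nonneg h1 (Real.exp_pos _).le)]
      refine mul_le_mul_of_nonneg_left (Real.exp_le_exp.2 ?_) h1
      rw [sum_update_mul α (fun e => q e y)]
      rw [Metric.mem_ball, dist_zero_right, Real.norm_eq_abs] at hτ
      have h2 := mul_nonneg (show 0 ≤ τ + α e / 2 by linarith [neg_abs_le τ]) (hq e y)
      linarith
    have hdiff : ∀ᵐ y ∂μ, ∀ τ ∈ Metric.ball (0 : ℝ) (α e / 2),
        HasDerivAt (fun τ => (l.map fun e => q e y).prod *
          Real.exp (-(∑ i, α i * q i y + τ * q e y))) (-(((e :: l).map fun e => q e y).prod *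
          Real.exp (-(∑ i, α i * q i y + τ * q e y)))) τ := by
      refine Filter.Eventually.of_forall fun y τ _ => ?_
      have h : HasDerivAt (fun τ => -(∑ i, α i * q i y + τ * q e y)) (-q e y) τ := by
        simpa using (((hasDerivAt_id τ).mul_const (q e y)).const_add (∑ i, α i * q i y)).fun_neg
      convert! h.exp.const_mul ((l.map fun e => q e y).prod) using 1
      simp only [List.map_cons, List.prod_cons]
      ring
    have hder := (hasDerivAt_integral_of_dominated_loc_of_deriv_le
      (Metric.ball_mem_nhds (0 : ℝ) hc)
      (Filter.Eventually.of_forall fun τ => by simpa only [hline'] using hmeas l _)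
      (by simpa using integrable_prod_mul_exp hm hq hint l α hα)
      (by simpa only [hline'] using (hmeas (e :: l) _).fun_neg) hbound
      (integrable_prod_mul_exp hm hq hint (e :: l) _ (update_mem_orthant hα e hc)) hdiff).2
    simp only [partialDeriv, lineDeriv, hline]
    rw [hder.deriv, integral_neg]
    simp

end Derivatives

/-! ### Gamma integrals -/

section GammaIntegrals

lemma integrableOn_rpow_mul_exp_neg_mul {s u : ℝ} (hs : 0 < s) (hu : 0 < u) :
    IntegrableOn (fun t => t ^ (s - 1) * Real.exp (-(u * t))) (Set.Ioi 0) := by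
  simpa using integrableOn_rpow_mul_exp_neg_mul_rpow (p := 1) (s := s - 1) (b := u)
    (by linarith) one_pos hu

/-- As `t → 0` the sum tends to `c 0`. If that were nonzero, the integrand would dominate a multiple
of `t ^ (M - 1)`, which is not integrable at `0`. -/
lemma coeff_zero_eq_zero_of_integrableOn {M u : ℝ} (hM : M ≤ 0) (n : ℕ) (c : ℕ → ℝ)
    (h : IntegrableOn (fun t => t ^ (M - 1) *
      ∑ j ∈ Finset.range (n + 1), c j * (t ^ j * Real.exp (-(t * u)))) (Set.Ioi 0)) : c 0 = 0 := by
  by_contra hc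
  let p : ℝ → ℝ := fun t => |∑ j ∈ Finset.range (n + 1), c j * (t ^ j * Real.exp (-(t * u)))|
  have hp : Continuous p := by fun_prop
  have hp0 : p 0 = |c 0| := by
    simp only [p]
    rw [Finset.sum_eq_single 0]
    · simp
    · intro j _ hj; simp [hj]
    · simp
  have hev : ∀ᶠ t in nhds 0, |c 0| / 2 < p t :=
    hp.continuousAt.eventually (lt_mem_nhds (by rw [hp0]; exact half_lt_self (abs_pos.2 hc)))
  obtain ⟨δ, hδ, hball⟩ := Metric.eventually_nhds_iff_ball.1 hev
  have h1 : IntegrableOn (fun t : ℝ => t ^ (M - 1)) (Set.Ioo 0 δ) := by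
    have h2 := (h.mono_set (fun t (ht : t ∈ Set.Ioo 0 δ) => ht.1)).norm.const_mul (2 / |c 0|)
    refine Integrable.mono' h2 ?_ ?_
    · exact (measurable_id.pow_const _).aestronglyMeasurable
    · refine (ae_restrict_iff' measurableSet_Ioo).2 (Filter.Eventually.of_forall fun t ht => ?_)
      have ht' := hball t (by
        rw [Metric.mem_ball, Real.dist_eq, sub_zero, abs_of_pos ht.1]; exact ht.2)
      have h3 : (0 : ℝ) < t ^ (M - 1) := Real.rpow_pos_of_pos ht.1 _
      have hc' : 0 < |c 0| := abs_pos.2 hc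
      rw [norm_mul, Real.norm_of_nonneg h3.le, Real.norm_eq_abs]
      change t ^ (M - 1) ≤ 2 / |c 0| * (t ^ (M - 1) * p t)
      rw [div_mul_eq_mul_div, le_div_iff₀ hc']
      nlinarith
  rw [intervalIntegral.integrableOn_Ioo_rpow_iff hδ] at h1
  linarith

/-- A convergent Mellin transform of a polynomial times an exponential is given by the formula
obtained by analytic continuation in the exponent. -/
lemma integral_rpow_mul_sum_mul_exp {u : ℝ} (hu : 0 < u) (n : ℕ) : ∀ (M : ℝ)
    (_ : ∀ j : ℕ, M ≠ -(j : ℝ)) (c : ℕ → ℝ)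
    (_ : IntegrableOn (fun t => t ^ (M - 1) *
      ∑ j ∈ Finset.range n, c j * (t ^ j * Real.exp (-(t * u)))) (Set.Ioi 0)),
    ∫ t in Set.Ioi 0, t ^ (M - 1) * ∑ j ∈ Finset.range n, c j * (t ^ j * Real.exp (-(t * u))) =
      ∑ j ∈ Finset.range n, c j * (Real.Gamma (M + j) * u ^ (-(M + j))) := by
  induction n with
  | zero => intro M _ c _; simp
  | succ n ih =>
    intro M hM c h
    -- For `M > 0` every term is a convergent Gamma integral. For `M ≤ 0` the leading coefficient
    -- vanishes, and the factor `t` common to the other terms raises `M` by one while the number of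
    -- terms drops by one; hence the induction over `n` with `M` and `c` general.
    rcases lt_or_ge 0 M with hpos | hneg
    · have hexp : ∀ j : ℕ, ∀ t ∈ Set.Ioi (0 : ℝ), t ^ (M - 1) * (c j * (t ^ j *
          Real.exp (-(t * u)))) = c j * (t ^ (M + j - 1) * Real.exp (-(u * t))) := by
        intro j t ht
        rw [show M + (j : ℝ) - 1 = M - 1 + j by ring, Real.rpow_add ht, Real.rpow_natCast,
          mul_comm u t]
        ring
      have hj : ∀ j : ℕ, 0 < M + j := fun j => by positivity
      simp only [Finset.mul_sum]
      rw [integral_finsetSum]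
      · refine Finset.sum_congr rfl fun j _ => ?_
        rw [setIntegral_congr_fun measurableSet_Ioi (hexp j), integral_const_mul,
          Real.integral_rpow_mul_exp_neg_mul_Ioi (hj j) hu, Real.rpow_neg hu.le, one_div,
          Real.inv_rpow hu.le]
        ring
      · intro j _
        have h2 := (integrableOn_rpow_mul_exp_neg_mul (hj j) hu).const_mul (c j)
        exact IntegrableOn.congr_fun h2 (fun t ht => (hexp j t ht).symm) measurableSet_Ioi
    · have hc := coeff_zero_eq_zero_of_integrableOn hneg n c h
      have hshift : ∀ t ∈ Set.Ioi (0 : ℝ), t ^ (M - 1) *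
          ∑ j ∈ Finset.range (n + 1), c j * (t ^ j * Real.exp (-(t * u))) = t ^ (M + 1 - 1) *
          ∑ j ∈ Finset.range n, c (j + 1) * (t ^ j * Real.exp (-(t * u))) := by
        intro t ht
        rw [Finset.sum_range_succ', hc, zero_mul, add_zero, show M + 1 - 1 = M - 1 + 1 by ring,
          Real.rpow_add_one (ne_of_gt ht), mul_assoc, Finset.mul_sum _ _ t]
        congr 1
        exact Finset.sum_congr rfl fun j _ => by ring
      have hM' : ∀ j : ℕ, M + 1 ≠ -(j : ℝ) := fun j hj => hM (j + 1) (by push_cast; linarith)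
      rw [setIntegral_congr_fun measurableSet_Ioi hshift,
        ih (M + 1) hM' _ (h.congr_fun hshift measurableSet_Ioi), Finset.sum_range_succ', hc]
      simp only [zero_mul, add_zero]
      refine Finset.sum_congr rfl fun j _ => ?_
      rw [show M + ((j + 1 : ℕ) : ℝ) = M + 1 + j by push_cast; ring]

lemma measurableSet_orthant (ι : Type*) [Finite ι] : MeasurableSet (orthant ι) :=
  (isOpen_orthant ι).measurableSet

lemma restrict_orthant (ι : Type*) [Fintype ι] : (volume : Measure (ι → ℝ)).restrict (orthant ι) =
    Measure.pi fun _ => volume.restrict (Set.Ioi 0) := by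
  have : orthant ι = Set.univ.pi fun _ => Set.Ioi 0 := by
    ext α; simp [orthant]
  rw [this, volume_pi, Measure.restrict_pi_pi]

/-- Schwinger's parametrization of a product of powers. -/
lemma lintegral_orthant_prod_rpow_mul_exp {ι : Type*} [Fintype ι] {A q : ι → ℝ}
    (hA : ∀ e, 0 < A e) (hq : ∀ e, 0 < q e) :
    ∫⁻ α in orthant ι, ENNReal.ofReal ((∏ e, α e ^ (A e - 1)) * Real.exp (-∑ e, α e * q e)) =
      ENNReal.ofReal (∏ e, Real.Gamma (A e) * q e ^ (-A e)) := by
  have h1 : ∀ α : ι → ℝ, (∏ e, α e ^ (A e - 1)) * Real.exp (-∑ e, α e * q e) =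
      ∏ e, α e ^ (A e - 1) * Real.exp (-(q e * α e)) := fun α => by
    rw [Finset.prod_mul_distrib, ← Real.exp_sum, Finset.sum_neg_distrib]
    simp only [mul_comm]
  have hi := fun e => integrableOn_rpow_mul_exp_neg_mul (hA e) (hq e)
  rw [← ofReal_integral_eq_lintegral_ofReal]
  · congr 1
    simp only [h1]
    rw [restrict_orthant, integral_fintype_prod_eq_prod
      (f := fun e t => t ^ (A e - 1) * Real.exp (-(q e * t)))]
    refine Finset.prod_congr rfl fun e _ => ?_
    rw [Real.integral_rpow_mul_exp_neg_mul_Ioi (hA e) (hq e), Real.rpow_neg (hq e).le, one_div,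
      Real.inv_rpow (hq e).le, mul_comm]
  · simp only [h1]
    rw [restrict_orthant]
    exact Integrable.fintype_prod_dep hi
  · refine (ae_restrict_iff' (measurableSet_orthant ι)).2 (Filter.Eventually.of_forall fun α hα => ?_)
    exact mul_nonneg (Finset.prod_nonneg fun e _ => Real.rpow_nonneg (hα e).le _)
      (Real.exp_pos _).le

end GammaIntegrals

/-! ### Affine charts of the positive simplex -/

section Chart

variable {N : ℕ}

lemma lintegral_comp_smul_of_pos {ι : Type*} [Fintype ι] (f : (ι → ℝ) → ENNReal) {t : ℝ}
    (ht : 0 < t) :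
    ∫⁻ b : ι → ℝ, f b = ENNReal.ofReal (t ^ Fintype.card ι) * ∫⁻ b : ι → ℝ, f (t • b) := by
  have h := (MeasurableEquiv.smul₀ (α := ι → ℝ) t ht.ne').measurableEmbedding.lintegral_map
    (μ := volume) f
  have hmap := Measure.map_addHaar_smul (volume : Measure (ι → ℝ)) ht.ne'
  rw [MeasurableEquiv.coe_smul₀, hmap, lintegral_smul_measure] at h
  rw [← h, smul_eq_mul, ← mul_assoc, ← ENNReal.ofReal_mul (by positivity), abs_of_pos (by positivity),
    Module.finrank_fintype_fun_eq_card, mul_inv_cancel₀ (by positivity), ENNReal.ofReal_one, one_mul]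

/-- Gluing of the coordinate `e₀` to the other coordinates. -/
def insertCoord (e₀ : Fin N) (z : ℝ × ({e : Fin N // e ≠ e₀} → ℝ)) : Fin N → ℝ :=
  fun e => if h : e = e₀ then z.1 else z.2 ⟨e, h⟩

lemma insertCoord_smul (e₀ : Fin N) (t : ℝ) (b : {e : Fin N // e ≠ e₀} → ℝ) :
    insertCoord e₀ (t, t • b) = t • affineChart e₀ b := by
  ext e
  by_cases h : e = e₀ <;> simp [insertCoord, affineChart, h]

lemma insertCoord_mem_orthant (e₀ : Fin N) (z : ℝ × ({e : Fin N // e ≠ e₀} → ℝ)) :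
    insertCoord e₀ z ∈ orthant (Fin N) ↔ 0 < z.1 ∧ z.2 ∈ orthant {e : Fin N // e ≠ e₀} := by
  constructor
  · intro h
    refine ⟨by simpa [insertCoord] using h e₀, fun e => ?_⟩
    simpa [insertCoord, e.2] using h e
  · rintro ⟨h1, h2⟩ e
    by_cases h : e = e₀
    · simpa [insertCoord, h] using h1
    · simpa [insertCoord, h] using h2 ⟨e, h⟩

lemma affineChart_mem_orthant {e₀ : Fin N} {b : {e : Fin N // e ≠ e₀} → ℝ}
    (hb : b ∈ orthant {e : Fin N // e ≠ e₀}) : affineChart e₀ b ∈ orthant (Fin N) := by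
  have := (insertCoord_mem_orthant e₀ (1, b)).2 ⟨one_pos, hb⟩
  exact this

lemma continuous_affineChart (e₀ : Fin N) : Continuous (affineChart e₀) := by
  refine continuous_pi fun e => ?_
  by_cases h : e = e₀
  · simp [affineChart, h, continuous_const]
  · simpa [affineChart, h] using continuous_apply _

lemma measurePreserving_insertCoord (e₀ : Fin N) : MeasurePreserving (insertCoord e₀) := by
  have hm : Measurable (insertCoord e₀) := by
    refine measurable_pi_lambda _ fun e => ?_
    by_cases h : e = e₀
    · simpa [insertCoord, h] using measurable_fst
    · simp only [insertCoord, h, dite_false]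
      exact (measurable_pi_apply _).comp measurable_snd
  refine ⟨hm, (Measure.pi_eq fun s hs => ?_).symm⟩
  have hpre : insertCoord e₀ ⁻¹' Set.univ.pi s =
      s e₀ ×ˢ Set.univ.pi fun e : {e : Fin N // e ≠ e₀} => s e := by
    ext z
    simp only [Set.mem_preimage, Set.mem_univ_pi, Set.mem_prod]
    constructor
    · intro h
      refine ⟨by simpa [insertCoord] using h e₀, fun e => ?_⟩
      simpa [insertCoord, e.2] using h e
    · rintro ⟨h1, h2⟩ e
      by_cases h : e = e₀
      · subst h; simpa [insertCoord] using h1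
      · simpa [insertCoord, h] using h2 ⟨e, h⟩
  rw [Measure.map_apply hm (MeasurableSet.univ_pi hs), hpre, Measure.volume_eq_prod,
    Measure.prod_prod, volume_pi_pi, Fintype.prod_eq_mul_prod_subtype_ne _ e₀]

/-- With the coordinate at `e₀` equal to `t`, rescaling the other `N - 1` coordinates by `t`
produces the Jacobian `t ^ (N - 1)`. -/
lemma lintegral_orthant_eq_lintegral_chart (e₀ : Fin N) {f : (Fin N → ℝ) → ENNReal}
    (hf : Measurable f) :
    ∫⁻ α in orthant (Fin N), f α = ∫⁻ b in orthant {e : Fin N // e ≠ e₀},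
      ∫⁻ t in Set.Ioi (0 : ℝ), ENNReal.ofReal (t ^ (N - 1)) * f (t • affineChart e₀ b) := by
  have hcard : Fintype.card {e : Fin N // e ≠ e₀} = N - 1 := by simp
  have hmp := measurePreserving_insertCoord e₀
  have hF : Measurable ((orthant (Fin N)).indicator f) := hf.indicator (measurableSet_orthant _)
  rw [← lintegral_indicator (measurableSet_orthant _), ← hmp.lintegral_comp hF, Measure.volume_eq_prod,
    lintegral_prod (fun z => (orthant (Fin N)).indicator f (insertCoord e₀ z))
      (hF.comp hmp.measurable).aemeasurable]
  have h1 : ∀ t : ℝ, ∫⁻ b, (orthant (Fin N)).indicator f (insertCoord e₀ (t, b)) =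
      (Set.Ioi (0 : ℝ)).indicator (fun t => ∫⁻ b in orthant {e : Fin N // e ≠ e₀},
        ENNReal.ofReal (t ^ (N - 1)) * f (t • affineChart e₀ b)) t := by
    intro t
    by_cases ht : 0 < t
    · rw [Set.indicator_of_mem (show t ∈ Set.Ioi 0 from ht), lintegral_comp_smul_of_pos _ ht, hcard,
        lintegral_const_mul' _ _ ENNReal.ofReal_ne_top, ← lintegral_indicator (measurableSet_orthant _)]
      congr 2
      ext b
      rw [insertCoord_smul]
      by_cases hb : b ∈ orthant {e : Fin N // e ≠ e₀}
      · rw [Set.indicator_of_mem (smul_mem_orthant ht (affineChart_mem_orthant hb)),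
          Set.indicator_of_mem hb]
      · rw [Set.indicator_of_notMem hb, Set.indicator_of_notMem]
        rw [← insertCoord_smul, insertCoord_mem_orthant]
        rintro ⟨-, h⟩
        refine hb fun e => ?_
        have := h e
        simp only [Pi.smul_apply, smul_eq_mul] at this
        exact (mul_pos_iff_of_pos_left ht).1 this
    · rw [Set.indicator_of_notMem (by simpa using ht)]
      have h0 : ∀ b, (orthant (Fin N)).indicator f (insertCoord e₀ (t, b)) = 0 := fun b =>
        Set.indicator_of_notMem (fun h => ht ((insertCoord_mem_orthant e₀ _).1 h).1) _
      simp only [h0, lintegral_zero]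
  simp only [h1]
  rw [lintegral_indicator measurableSet_Ioi, lintegral_lintegral_swap]
  refine Measurable.aemeasurable ?_
  have hc := (continuous_affineChart e₀).measurable
  refine Measurable.mul ?_ ?_
  · exact (measurable_fst.pow_const _).ennreal_ofReal
  · exact hf.comp (measurable_fst.smul (hc.comp measurable_snd))

end Chart

/-! ### Positivity of the polynomials of a convergent integral -/

/-- A positive integrable function cannot be rescaled by a linear map with the wrong factor. -/
lemma not_integrable_of_comp_linearMap {E : Type*} [NormedAddCommGroup E] [NormedSpace ℝ E]
    [FiniteDimensional ℝ E] [MeasurableSpace E] [BorelSpace E] {μ : Measure E}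
    [μ.IsAddHaarMeasure] {T : E →ₗ[ℝ] E} (hT : LinearMap.det T ≠ 0) {F : E → ℝ} {c : ℝ}
    (hF : ∀ᵐ y ∂μ, 0 < F y) (hTF : ∀ y, F (T y) = c * F y) (hc : c * |LinearMap.det T| ≠ 1) :
    ¬ Integrable F μ := by
  intro hi
  have hmap := Measure.map_linearMap_addHaar_eq_smul_addHaar μ hT
  have hmeas : Measurable T := T.continuous_of_finiteDimensional.measurable
  have hi' : Integrable F (μ.map T) := by
    rw [hmap]
    exact hi.smul_measure ENNReal.ofReal_ne_top
  have h1 := integral_map hmeas.aemeasurable hi'.aestronglyMeasurable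
  rw [hmap, integral_smul_measure, ENNReal.toReal_ofReal (abs_nonneg _)] at h1
  simp only [hTF, integral_const_mul, smul_eq_mul, abs_inv] at h1
  have hdet : 0 < |LinearMap.det T| := abs_pos.2 hT
  have hpos : 0 < ∫ y, F y ∂μ := by
    rw [integral_pos_iff_support_of_nonneg_ae (hF.mono fun y hy => hy.le) hi]
    have h2 : Function.support F =ᵐ[μ] Set.univ :=
      Filter.eventuallyEq_univ.2 (hF.mono fun y hy => hy.ne')
    rw [measure_congr h2]
    exact Measure.measure_univ_pos.2 (NeZero.ne μ)
  apply hc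
  field_simp at h1
  rw [mul_comm]
  exact h1.symm

lemma measure_setOf_eq_zero {E : Type*} [NormedAddCommGroup E] [NormedSpace ℝ E]
    [FiniteDimensional ℝ E] [MeasurableSpace E] [BorelSpace E] (μ : Measure E)
    [μ.IsAddHaarMeasure] {f : E →ₗ[ℝ] ℝ} (hf : f ≠ 0) (c : ℝ) : μ {y | f y = c} = 0 := by
  rcases Set.eq_empty_or_nonempty {y | f y = c} with h | ⟨y₀, hy₀⟩
  · rw [h, measure_empty]
  · refine measure_mono_null (fun y hy => ?_) (Measure.addHaar_affineSubspace μ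
      (AffineSubspace.mk' y₀ (LinearMap.ker f)) fun htop => hf ?_)
    · change y ∈ AffineSubspace.mk' y₀ (LinearMap.ker f)
      rw [AffineSubspace.mem_mk', vsub_eq_sub, LinearMap.mem_ker, map_sub, hy, hy₀, sub_self]
    · have := congrArg AffineSubspace.direction htop
      rw [AffineSubspace.direction_mk', AffineSubspace.direction_top] at this
      exact LinearMap.ker_eq_top.1 this

namespace FeynmanGraph

variable {m k N d : ℕ}

/-- The coordinate `a` of the difference of the internal endpoints of an edge. -/
def intIncCoord (G : FeynmanGraph m k N) (e : Fin N) (a : Fin d) :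
    (Fin k → EuclideanSpace ℝ (Fin d)) →ₗ[ℝ] ℝ where
  toFun y := ∑ v, G.inc ℝ e (Sum.inr v) * y v a
  map_add' y z := by simp [mul_add, Finset.sum_add_distrib]
  map_smul' c y := by
    simp only [Pi.smul_apply, PiLp.smul_apply, smul_eq_mul, RingHom.id_apply, Finset.mul_sum]
    exact Finset.sum_congr rfl fun v _ => by ring

lemma Q_eq_sum_intIncCoord (G : FeynmanGraph m k N) (x : Fin m → EuclideanSpace ℝ (Fin d))
    (y : Fin k → EuclideanSpace ℝ (Fin d)) (e : Fin N) : G.Q (Sum.elim x y) e =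
      ∑ a, (G.intIncCoord e a y + G.extInc (fun l => x l a) e) ^ 2 :=
  G.Q_eq_sum x y e

lemma Q_eq_zero_iff (G : FeynmanGraph m k N) (x : Fin m → EuclideanSpace ℝ (Fin d))
    (y : Fin k → EuclideanSpace ℝ (Fin d)) (e : Fin N) : G.Q (Sum.elim x y) e = 0 ↔
      ∀ a, G.intIncCoord e a y + G.extInc (fun l => x l a) e = 0 := by
  rw [Q_eq_sum_intIncCoord, Finset.sum_eq_zero_iff_of_nonneg fun a _ => sq_nonneg _]
  simp

lemma intIncCoord_ne_zero (G : FeynmanGraph m k N) {e : Fin N} {v : Fin k}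
    (h : G.inc ℝ e (Sum.inr v) ≠ 0) (a : Fin d) : G.intIncCoord e a ≠ 0 := by
  intro h0
  have := LinearMap.congr_fun h0 (Pi.single v (EuclideanSpace.single a 1))
  simp only [intIncCoord, LinearMap.coe_mk, AddHom.coe_mk, LinearMap.zero_apply] at this
  rw [Finset.sum_eq_single v] at this
  · simp at this
    exact h this
  · intro w _ hw
    simp [hw]
  · simp

/-- For an edge with an internal endpoint, the zero set lies in an affine hyperplane. For an edge
between external vertices, positivity is the distinctness of their positions. -/
lemma ae_Q_pos (G : FeynmanGraph m k N) (hd : 0 < d) {x : Fin m → EuclideanSpace ℝ (Fin d)}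
    (hx : Function.Injective x) :
    ∀ᵐ y : Fin k → EuclideanSpace ℝ (Fin d), ∀ e, 0 < G.Q (Sum.elim x y) e := by
  rw [ae_all_iff]
  intro e
  have hnn : ∀ y, 0 < G.Q (Sum.elim x y) e ↔ G.Q (Sum.elim x y) e ≠ 0 := fun y =>
    (G.Q_nonneg _ e).lt_iff_ne'
  simp only [hnn]
  by_cases h : ∃ v : Fin k, G.inc ℝ e (Sum.inr v) ≠ 0
  · obtain ⟨v, hv⟩ := h
    let a : Fin d := ⟨0, hd⟩
    have h0 := measure_setOf_eq_zero (volume : Measure (Fin k → EuclideanSpace ℝ (Fin d)))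
      (G.intIncCoord_ne_zero hv a) (-G.extInc (fun l => x l a) e)
    rw [ae_iff]
    refine measure_mono_null (fun y hy => ?_) h0
    have hy' : G.Q (Sum.elim x y) e = 0 := by simpa using hy
    exact eq_neg_of_add_eq_zero_left ((G.Q_eq_zero_iff x y e).1 hy' a)
  · push Not at h
    have hinl : ∀ w : Fin m ⊕ Fin k, G.inc ℝ e w ≠ 0 → ∃ l, w = Sum.inl l := by
      rintro (l | v) hw
      · exact ⟨l, rfl⟩
      · exact absurd (h v) hw
    have hne := G.src_ne_tgt e
    obtain ⟨l, hl⟩ := hinl (G.src e) (by simp [inc, hne])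
    obtain ⟨l', hl'⟩ := hinl (G.tgt e) (by simp [inc, hne.symm])
    refine Filter.Eventually.of_forall fun y h0 => hne ?_
    rw [Q_eq, hl, hl'] at h0
    have : x l = x l' := by simpa [sub_eq_zero] using h0
    rw [hl, hl', hx this]

lemma positionIntegrand_nonneg (G : FeynmanGraph m k N) (lam : ℝ) (ν : Fin N → ℝ)
    (x : Fin m → EuclideanSpace ℝ (Fin d)) (y : Fin k → EuclideanSpace ℝ (Fin d)) :
    0 ≤ G.positionIntegrand lam ν x y :=
  one_div_nonneg.2 (Finset.prod_nonneg fun e _ => Real.rpow_nonneg (G.Q_nonneg _ e) _)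

lemma ae_positionIntegrand_pos (G : FeynmanGraph m k N) (hd : 0 < d) (lam : ℝ) (ν : Fin N → ℝ)
    {x : Fin m → EuclideanSpace ℝ (Fin d)} (hx : Function.Injective x) :
    ∀ᵐ y, 0 < G.positionIntegrand lam ν x y := by
  filter_upwards [G.ae_Q_pos hd hx] with y hy
  exact one_div_pos.2 (Finset.prod_pos fun e _ => Real.rpow_pos_of_pos (hy e) _)

/-- If `Ψ̃` vanishes somewhere in the positive orthant, then the integrand is invariant under some
translations. -/
lemma PsiDual_pos (G : FeynmanGraph m k N) (hd : 0 < d) {lam : ℝ} {ν : Fin N → ℝ}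
    {x : Fin m → EuclideanSpace ℝ (Fin d)} (hx : Function.Injective x)
    (hconv : G.Converges lam ν x) {α : Fin N → ℝ} (hα : α ∈ orthant (Fin N)) :
    0 < G.PsiDual α := by
  have hpsd := posSemidef_weightedGram (fun e (v : Fin k) => G.inc ℝ e (Sum.inr v))
    fun e => (hα e).le
  have hnn := hpsd.det_nonneg
  rw [det_weightedGram_inc] at hnn
  refine hnn.lt_of_ne fun h0 => ?_
  rw [← det_weightedGram_inc] at h0
  obtain ⟨z, hz, hLz⟩ := Matrix.exists_mulVec_eq_zero_iff.2 h0.symm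
  -- All weights are positive, so a null vector of the Laplacian has zero coboundary on every edge:
  -- displacing the internal vertices along `z` changes no `Q_e`.
  have hz0 : ∀ e, ∑ v : Fin k, G.inc ℝ e (Sum.inr v) * z v = 0 := by
    have h1 := weightedGram_dotProduct (fun e (v : Fin k) => G.inc ℝ e (Sum.inr v)) α z
    rw [hLz, dotProduct_zero, eq_comm, Finset.sum_eq_zero_iff_of_nonneg fun e _ =>
      mul_nonneg (hα e).le (sq_nonneg _)] at h1
    intro e
    simpa [(hα e).ne'] using h1 e (Finset.mem_univ e)
  obtain ⟨v₀, hv₀⟩ : ∃ v, z v ≠ 0 := Function.ne_iff.1 hz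
  let a₀ : Fin d := ⟨0, hd⟩
  let w : Fin k → EuclideanSpace ℝ (Fin d) := fun v => z v • EuclideanSpace.single a₀ 1
  -- Normalized so that `y ↦ y + f y • w` has determinant `1 + f w = 2`, although it leaves the
  -- integrand invariant.
  let f : (Fin k → EuclideanSpace ℝ (Fin d)) →ₗ[ℝ] ℝ :=
    (z v₀)⁻¹ • (EuclideanSpace.proj a₀).toLinearMap ∘ₗ LinearMap.proj v₀
  have hfw : f w = 1 := by simp [f, w, hv₀]
  have hwe : ∀ e (a : Fin d), G.intIncCoord e a w = 0 := by
    intro e a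
    have : G.intIncCoord e a w = (∑ v : Fin k, G.inc ℝ e (Sum.inr v) * z v) *
        (EuclideanSpace.single a₀ (1 : ℝ) : EuclideanSpace ℝ (Fin d)) a := by
      simp only [intIncCoord, LinearMap.coe_mk, AddHom.coe_mk, w, PiLp.smul_apply, smul_eq_mul,
        Finset.sum_mul, mul_assoc]
    rw [this, hz0, zero_mul]
  have hdet : LinearMap.det (LinearMap.transvection f w) = 2 := by
    rw [LinearMap.transvection.det, hfw]; norm_num
  refine not_integrable_of_comp_linearMap (T := LinearMap.transvection f w) (c := 1)
    (by rw [hdet]; norm_num) (G.ae_positionIntegrand_pos hd lam ν hx) (fun y => ?_)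
    (by rw [hdet]; norm_num) hconv
  rw [one_mul, positionIntegrand, positionIntegrand]
  simp only [Q_eq_sum_intIncCoord, LinearMap.transvection.apply, map_add, map_smul, hwe,
    smul_zero, add_zero]

/-- The minimum is attained: the centres of the completed squares, one for each coordinate, are the
positions sought. -/
lemma PhiDual_div_PsiDual_eq (G : FeynmanGraph m k N) (x : Fin m → EuclideanSpace ℝ (Fin d))
    {α : Fin N → ℝ} (hΨ : G.PsiDual α ≠ 0) : ∃ y : Fin k → EuclideanSpace ℝ (Fin d),
      G.PhiDual x α / G.PsiDual α = ∑ e, α e * G.Q (Sum.elim x y) e := by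
  rw [← det_weightedGram_inc] at hΨ
  choose h hh using fun a : Fin d => exists_sum_sq_eq_add_minQuad
    (fun e (v : Fin k) => G.inc ℝ e (Sum.inr v)) (G.extInc fun l => x l a) α hΨ
  refine ⟨fun v => WithLp.toLp 2 fun a => -h a v, ?_⟩
  rw [← sum_minQuad]
  simp only [Q_eq_sum, Finset.mul_sum]
  rw [Finset.sum_comm]
  refine Finset.sum_congr rfl fun a _ => ?_
  have := hh a (-h a)
  simpa using this.symm

/-- If `Φ̃` vanishes somewhere in the positive orthant, then the integrand is homogeneous around
some point. -/
lemma PhiDual_pos (G : FeynmanGraph m k N) (hd : 0 < d) {lam : ℝ} {ν : Fin N → ℝ}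
    {x : Fin m → EuclideanSpace ℝ (Fin d)} (hx : Function.Injective x)
    (hconv : G.Converges lam ν x) (hM : G.superficialDegree d lam ν ≠ 0)
    {α : Fin N → ℝ} (hα : α ∈ orthant (Fin N)) : 0 < G.PhiDual x α := by
  have hΨ := G.PsiDual_pos hd hx hconv hα
  obtain ⟨y₀, hy₀⟩ := G.PhiDual_div_PsiDual_eq x hΨ.ne'
  have hterm : ∀ e, 0 ≤ α e * G.Q (Sum.elim x y₀) e := fun e =>
    mul_nonneg (hα e).le (G.Q_nonneg _ e)
  have hnn : 0 ≤ G.PhiDual x α / G.PsiDual α := hy₀ ▸ Finset.sum_nonneg fun e _ => hterm e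
  have hnn' : 0 ≤ G.PhiDual x α := by
    rw [← div_mul_cancel₀ (G.PhiDual x α) hΨ.ne']
    exact mul_nonneg hnn hΨ.le
  refine hnn'.lt_of_ne fun h0 => ?_
  rw [← h0, zero_div, eq_comm, Finset.sum_eq_zero_iff_of_nonneg fun e _ => hterm e] at hy₀
  -- A zero of `Φ̃` makes every `Q_e` vanish at `y₀`, so each `Q_e` is a homogeneous quadratic form
  -- in the displacement from `y₀`.
  have hQ0 : ∀ e (a : Fin d), G.intIncCoord e a y₀ + G.extInc (fun l => x l a) e = 0 := by
    intro e
    have := hy₀ e (Finset.mem_univ e)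
    rw [mul_eq_zero_iff_left (hα e).ne'] at this
    exact (G.Q_eq_zero_iff x y₀ e).1 this
  have hQ : ∀ y e, G.Q (Sum.elim x (y₀ + y)) e = ∑ a, G.intIncCoord e a y ^ 2 := by
    intro y e
    rw [Q_eq_sum_intIncCoord]
    refine Finset.sum_congr rfl fun a _ => ?_
    rw [map_add, add_right_comm, hQ0, zero_add]
  have hQs : ∀ y e, G.Q (Sum.elim x (y₀ + (2 : ℝ) • y)) e =
      2 ^ (2 : ℝ) * G.Q (Sum.elim x (y₀ + y)) e := by
    intro y e
    simp only [hQ, map_smul, smul_eq_mul, mul_pow, Finset.mul_sum]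
    norm_num
  have hhom : ∀ y, G.positionIntegrand lam ν x (y₀ + (2 : ℝ) • y) =
      2 ^ (-(2 * (lam * ∑ e, ν e))) * G.positionIntegrand lam ν x (y₀ + y) := by
    intro y
    have h2 : ∀ e, (2 : ℝ) ^ (2 * (lam * ν e)) = ((2 : ℝ) ^ (2 : ℝ)) ^ (lam * ν e) := fun e =>
      Real.rpow_mul (by norm_num) _ _
    simp only [positionIntegrand, hQs]
    rw [Finset.prod_congr rfl fun e _ => Real.mul_rpow (by positivity) (G.Q_nonneg _ e),
      Finset.prod_mul_distrib, ← Finset.prod_congr rfl fun e _ => h2 e,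
      ← Real.rpow_sum_of_pos two_pos, ← Finset.mul_sum, ← Finset.mul_sum, Real.rpow_neg two_pos.le,
      one_div, mul_inv, one_div]
  have hae := (measurePreserving_add_left
    (volume : Measure (Fin k → EuclideanSpace ℝ (Fin d))) y₀).quasiMeasurePreserving.ae
      (G.ae_positionIntegrand_pos hd lam ν hx)
  have hfr : Module.finrank ℝ (Fin k → EuclideanSpace ℝ (Fin d)) = k * d := by
    rw [Module.finrank_pi_fintype]; simp
  have hdet : LinearMap.det ((2 : ℝ) • (LinearMap.id :
      (Fin k → EuclideanSpace ℝ (Fin d)) →ₗ[ℝ] _)) = 2 ^ (k * d) := by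
    rw [LinearMap.det_smul, LinearMap.det_id, mul_one, hfr]
  refine not_integrable_of_comp_linearMap (T := (2 : ℝ) • LinearMap.id)
    (F := fun y => G.positionIntegrand lam ν x (y₀ + y)) (by rw [hdet]; positivity) hae
    (fun y => by simpa using hhom y) ?_ (hconv.comp_add_left y₀)
  -- The scaling factor times the determinant of the dilation is `2 ^ (-2 * M_G)`, which equals `1`
  -- only for `M_G = 0`.
  rw [hdet, abs_of_pos (by positivity), ← Real.rpow_natCast, ← Real.rpow_add two_pos]
  intro h1
  have h2 := congrArg Real.log h1
  rw [Real.log_rpow two_pos, Real.log_one, mul_eq_zero_iff_right (Real.log_pos one_lt_two).ne'] at h2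
  apply hM
  rw [superficialDegree]
  push_cast at h2
  linarith

/-! ### Homogeneity and smoothness of the polynomials -/

lemma dualForestPoly_smul (G : FeynmanGraph m k N) {p : Finset (Finset (Fin m ⊕ Fin k))} {r : ℕ}
    (hr : r + p.card = m + k) (t : ℝ) (α : Fin N → ℝ) :
    G.dualForestPoly p (t • α) = t ^ r * G.dualForestPoly p α := by
  classical
  rw [dualForestPoly, dualForestPoly, Finset.mul_sum]
  refine Finset.sum_congr rfl fun F hF => ?_
  have h := ((G.isSpanningForest_iff p F).1 (Finset.mem_filter.1 hF).2).1
  have hr' : r = F.card := by omega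
  simp only [Pi.smul_apply, smul_eq_mul, Finset.prod_mul_distrib, Finset.prod_const, hr']

lemma PsiDual_smul (G : FeynmanGraph m k N) (t : ℝ) (α : Fin N → ℝ) :
    G.PsiDual (t • α) = t ^ k * G.PsiDual α :=
  G.dualForestPoly_smul (by rw [card_singletonPartition, add_comm]) t α

lemma PhiDual_smul (G : FeynmanGraph m k N) (x : Fin m → EuclideanSpace ℝ (Fin d)) (t : ℝ)
    (α : Fin N → ℝ) : G.PhiDual x (t • α) = t ^ (k + 1) * G.PhiDual x α := by
  simp only [PhiDual, Finset.mul_sum]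
  refine Finset.sum_congr rfl fun i _ => Finset.sum_congr rfl fun j hj => ?_
  have hij : i ≠ j := (Finset.mem_filter.1 hj).2.ne
  have := card_pairPartition (k := k) hij
  rw [G.dualForestPoly_smul (r := k + 1) (by omega)]
  ring

open scoped ContDiff in
lemma contDiff_dualForestPoly (G : FeynmanGraph m k N) (p : Finset (Finset (Fin m ⊕ Fin k))) :
    ContDiff ℝ ∞ (G.dualForestPoly p) := by
  unfold dualForestPoly
  fun_prop

open scoped ContDiff in
lemma contDiff_PsiDual (G : FeynmanGraph m k N) : ContDiff ℝ ∞ G.PsiDual :=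
  G.contDiff_dualForestPoly _

open scoped ContDiff in
lemma contDiff_PhiDual (G : FeynmanGraph m k N) (x : Fin m → EuclideanSpace ℝ (Fin d)) :
    ContDiff ℝ ∞ (G.PhiDual x) := by
  have := G.contDiff_dualForestPoly
  unfold PhiDual
  fun_prop

/-- The function `1 / (Φ̃ ^ M * Ψ̃ ^ (d / 2 - M))`. -/
def dualKernel (G : FeynmanGraph m k N) (x : Fin m → EuclideanSpace ℝ (Fin d)) (M : ℝ)
    (α : Fin N → ℝ) : ℝ :=
  1 / (G.PhiDual x α ^ M * G.PsiDual α ^ ((d : ℝ) / 2 - M))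

lemma dualIntegrand_eq (G : FeynmanGraph m k N) (lam : ℝ) (ν : Fin N → ℝ)
    (x : Fin m → EuclideanSpace ℝ (Fin d)) (n : Fin N → ℕ) (α : Fin N → ℝ) :
    G.dualIntegrand lam ν x n α = (∏ e, α e ^ ((n e : ℝ) + lam * ν e - 1)) *
      listDeriv (multiplicityList n) (G.dualKernel x (G.superficialDegree d lam ν)) α := by
  rw [dualIntegrand, multiPartialDeriv_eq_listDeriv]
  rfl

lemma prod_smul_rpow {A : Fin N → ℝ} {t : ℝ} (ht : 0 < t) {α : Fin N → ℝ}
    (hα : α ∈ orthant (Fin N)) :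
    ∏ e, (t • α) e ^ (A e - 1) = t ^ (∑ e, A e - N) * ∏ e, α e ^ (A e - 1) := by
  simp only [Pi.smul_apply, smul_eq_mul]
  rw [Finset.prod_congr rfl fun e _ => Real.mul_rpow ht.le (hα e).le, Finset.prod_mul_distrib,
    ← Real.rpow_sum_of_pos ht]
  simp

lemma sqrt_pow_eq_rpow {t : ℝ} (ht : 0 ≤ t) (j : ℕ) : √t ^ j = t ^ ((j : ℝ) / 2) := by
  rw [Real.sqrt_eq_rpow, ← Real.rpow_natCast, ← Real.rpow_mul ht]
  ring_nf

/-- `Φ̃` has degree `k + 1` and `Ψ̃` degree `k`, and `(k + 1) M + k (d/2 - M) = M + dk/2`. -/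
lemma dualKernel_smul (G : FeynmanGraph m k N) {x : Fin m → EuclideanSpace ℝ (Fin d)} (M : ℝ)
    {α : Fin N → ℝ} (hΨ : 0 < G.PsiDual α) (hΦ : 0 < G.PhiDual x α) {t : ℝ} (ht : 0 < t) :
    G.dualKernel x M (t • α) = t ^ (-(M + d / 2 * k)) * G.dualKernel x M α := by
  have h1 : (t ^ (k + 1)) ^ M * (t ^ k) ^ ((d : ℝ) / 2 - M) = t ^ (M + d / 2 * k) := by
    rw [← Real.rpow_natCast, ← Real.rpow_natCast, ← Real.rpow_mul ht.le, ← Real.rpow_mul ht.le,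
      ← Real.rpow_add ht]
    push_cast
    ring_nf
  rw [dualKernel, dualKernel, PhiDual_smul, PsiDual_smul, Real.mul_rpow (by positivity) hΦ.le,
    Real.mul_rpow (by positivity) hΨ.le, mul_mul_mul_comm, h1, Real.rpow_neg ht.le]
  field_simp

/-- The monomial has degree `∑ (n_e + λν_e) - N`, the kernel `-(M_G + dk/2) = -λ ∑ ν_e`, and the
derivatives lower the degree by `∑ n_e`. -/
lemma dualIntegrand_homogeneous (G : FeynmanGraph m k N) (hd : 0 < d) {lam : ℝ} {ν : Fin N → ℝ}
    {x : Fin m → EuclideanSpace ℝ (Fin d)} (hx : Function.Injective x)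
    (hconv : G.Converges lam ν x) (hM : G.superficialDegree d lam ν ≠ 0) (n : Fin N → ℕ)
    {α : Fin N → ℝ} (hα : α ∈ orthant (Fin N)) {t : ℝ} (ht : 0 < t) :
    G.dualIntegrand lam ν x n (t • α) = t ^ (-(N : ℤ)) * G.dualIntegrand lam ν x n α := by
  have h := listDeriv_homogeneous (fun t ht α hα => G.dualKernel_smul (G.superficialDegree d lam ν)
    (G.PsiDual_pos hd hx hconv hα) (G.PhiDual_pos hd hx hconv hM hα) ht) (multiplicityList n) t ht
      α hα
  rw [dualIntegrand_eq, dualIntegrand_eq, h, prod_smul_rpow ht hα, length_multiplicityList,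
    mul_mul_mul_comm, ← Real.rpow_add ht, ← Real.rpow_intCast]
  congr 2
  rw [superficialDegree, Finset.sum_add_distrib, ← Finset.mul_sum]
  push_cast
  ring

/-! ### The parametric representation -/

/-- The Gaussian factor `∫ exp(-∑ α_e Q_e) dy` without its exponential. -/
def gaussFactor (G : FeynmanGraph m k N) (d : ℕ) (α : Fin N → ℝ) : ℝ :=
  (√Real.pi ^ k / √(G.PsiDual α)) ^ d

open scoped ContDiff in
lemma contDiffOn_gaussFactor (G : FeynmanGraph m k N) {U : Set (Fin N → ℝ)}
    (hΨ : ∀ α ∈ U, 0 < G.PsiDual α) : ContDiffOn ℝ ∞ (G.gaussFactor d) U := by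
  have h := G.contDiff_PsiDual.contDiffOn (s := U)
  exact (contDiffOn_const.div (h.sqrt fun α hα => (hΨ α hα).ne')
    fun α hα => (Real.sqrt_pos.2 (hΨ α hα)).ne').pow d

/-- The origin of the dual kernel: it is what remains when the exponential `exp(-tΦ̃/Ψ̃)` is
replaced by its Mellin transform without the factor `Γ(M)`. -/
lemma gaussFactor_mul_rpow (G : FeynmanGraph m k N) {x : Fin m → EuclideanSpace ℝ (Fin d)} (M : ℝ)
    {α : Fin N → ℝ} (hΨ : 0 < G.PsiDual α) (hΦ : 0 < G.PhiDual x α) :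
    G.gaussFactor d α * (G.PhiDual x α / G.PsiDual α) ^ (-M) =
      (√Real.pi ^ k) ^ d * G.dualKernel x M α := by
  rw [gaussFactor, dualKernel, div_pow, sqrt_pow_eq_rpow hΨ.le, Real.rpow_neg (by positivity),
    Real.div_rpow hΦ.le hΨ.le, Real.rpow_sub hΨ]
  have h1 := Real.rpow_pos_of_pos hΨ ((d : ℝ) / 2)
  have h2 := Real.rpow_pos_of_pos hΨ M
  have h3 := Real.rpow_pos_of_pos hΦ M
  field_simp

lemma gaussFactor_smul (G : FeynmanGraph m k N) {α : Fin N → ℝ} {t : ℝ} (ht : 0 < t) :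
    G.gaussFactor d (t • α) = t ^ (-((d : ℝ) / 2 * k)) * G.gaussFactor d α := by
  have h1 : √(t ^ k) ^ d = t ^ ((d : ℝ) / 2 * k) := by
    rw [sqrt_pow_eq_rpow (by positivity), ← Real.rpow_natCast t k, ← Real.rpow_mul ht.le, mul_comm]
  rw [gaussFactor, gaussFactor, PsiDual_smul, Real.sqrt_mul (by positivity), div_pow, div_pow,
    mul_pow, h1, Real.rpow_neg ht.le]
  field_simp

lemma measurable_Q (G : FeynmanGraph m k N) (x : Fin m → EuclideanSpace ℝ (Fin d)) (e : Fin N) :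
    Measurable fun y : Fin k → EuclideanSpace ℝ (Fin d) => G.Q (Sum.elim x y) e := by
  simp only [Q_eq_sum]
  refine Continuous.measurable ?_
  fun_prop

/-- The Gaussian integral with polynomial insertions. -/
def gaussMoment (G : FeynmanGraph m k N) (x : Fin m → EuclideanSpace ℝ (Fin d)) (n : Fin N → ℕ)
    (α : Fin N → ℝ) : ℝ :=
  ∫ y : Fin k → EuclideanSpace ℝ (Fin d), (∏ e, G.Q (Sum.elim x y) e ^ n e) *
    Real.exp (-∑ e, α e * G.Q (Sum.elim x y) e)

lemma integrable_gaussMoment (G : FeynmanGraph m k N) (x : Fin m → EuclideanSpace ℝ (Fin d))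
    (hΨ : ∀ α ∈ orthant (Fin N), 0 < G.PsiDual α) (n : Fin N → ℕ) {α : Fin N → ℝ}
    (hα : α ∈ orthant (Fin N)) :
    Integrable fun y : Fin k → EuclideanSpace ℝ (Fin d) => (∏ e, G.Q (Sum.elim x y) e ^ n e) *
      Real.exp (-∑ e, α e * G.Q (Sum.elim x y) e) := by
  simpa only [prod_map_multiplicityList] using integrable_prod_mul_exp (G.measurable_Q x)
    (fun e y => G.Q_nonneg _ e) (fun α hα => (G.integral_exp_neg_sum_Q x (fun e => (hα e).le)
      (hΨ α hα).ne').1) (multiplicityList n) α hα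

/-- The Gaussian moments and the derivatives of the dual kernel are given by the same
coefficients. -/
lemma exists_gaussMoment_eq_sum (G : FeynmanGraph m k N) (x : Fin m → EuclideanSpace ℝ (Fin d))
    (hΨ : ∀ α ∈ orthant (Fin N), 0 < G.PsiDual α) (hΦ : ∀ α ∈ orthant (Fin N), 0 < G.PhiDual x α)
    (n : Fin N → ℕ) : ∃ (L : ℕ) (g : ℕ → (Fin N → ℝ) → ℝ),
      (∀ j, ContinuousOn (g j) (orthant (Fin N))) ∧
      (∀ α ∈ orthant (Fin N), ∀ t : ℝ, 0 < t → t ^ (∑ e, n e) * G.gaussMoment x n (t • α) =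
        (-1) ^ (∑ e, n e) * (t ^ (-((d : ℝ) / 2 * k)) * ∑ j ∈ Finset.range L, g j α *
          (t ^ j * Real.exp (-(t * (G.PhiDual x α / G.PsiDual α)))))) ∧
      ∀ α ∈ orthant (Fin N), ∀ M : ℝ, (∀ j : ℕ, M ≠ -(j : ℝ)) →
        (√Real.pi ^ k) ^ d * Real.Gamma M * listDeriv (multiplicityList n) (G.dualKernel x M) α =
          ∑ j ∈ Finset.range L, g j α *
            (Real.Gamma (M + j) * (G.PhiDual x α / G.PsiDual α) ^ (-(M + j))) := by
  have hU := isOpen_orthant (Fin N)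
  obtain ⟨g, hg, -, hgφ⟩ := exists_listDeriv_eq_sum hU (G.contDiffOn_gaussFactor (d := d) hΨ)
    (u := fun α => G.PhiDual x α / G.PsiDual α)
    ((G.contDiff_PhiDual x).contDiffOn.div G.contDiff_PsiDual.contDiffOn
      fun α hα => (hΨ α hα).ne') (fun α hα => div_pos (hΦ α hα) (hΨ α hα)) (multiplicityList n)
  refine ⟨(multiplicityList n).length + 1, g, fun j => (hg j).continuousOn, fun α hα t ht => ?_, fun α hα M hM => ?_⟩
  -- For fixed `t` these kernels give the derivatives of the Gaussian integral with each `Q_e`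
  -- scaled by `t`. Differentiating that integral under the sign yields the moment at `t • α` times
  -- `t ^ (∑ n_e)`.
  · have h1 := hgφ (fun j r => t ^ j * Real.exp (-(t * r)))
      (fun j r _ => hasDerivAt_exp_kernel t j r) α hα
    beta_reduce at h1
    rw [← h1]
    have hint : ∀ β ∈ orthant (Fin N), Integrable
        (fun y : Fin k → EuclideanSpace ℝ (Fin d) =>
          Real.exp (-∑ e, β e * (t * G.Q (Sum.elim x y) e))) ∧
        ∫ y : Fin k → EuclideanSpace ℝ (Fin d),
          Real.exp (-∑ e, β e * (t * G.Q (Sum.elim x y) e)) = t ^ (-((d : ℝ) / 2 * k)) *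
            (G.gaussFactor d β * (t ^ 0 * Real.exp (-(t * (G.PhiDual x β / G.PsiDual β))))) := by
      intro β hβ
      have h2 := G.integral_exp_neg_sum_Q x (fun e => (smul_mem_orthant ht hβ e).le)
        (hΨ _ (smul_mem_orthant ht hβ)).ne'
      have h3 : G.PhiDual x (t • β) / G.PsiDual (t • β) =
          t * (G.PhiDual x β / G.PsiDual β) := by
        rw [PhiDual_smul, PsiDual_smul]
        have := (hΨ β hβ).ne'
        field_simp
        ring
      have h4 := G.gaussFactor_smul (d := d) (α := β) ht
      rw [gaussFactor] at h4
      have h5 : ∀ (y : Fin k → EuclideanSpace ℝ (Fin d)) e,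
          (t • β) e * G.Q (Sum.elim x y) e = β e * (t * G.Q (Sum.elim x y) e) := fun y e => by
        simp only [Pi.smul_apply, smul_eq_mul]; ring
      rw [h3, h4] at h2
      simp only [h5] at h2
      refine ⟨h2.1, h2.2.trans ?_⟩
      ring
    have h6 := listDeriv_integral_exp (μ := (volume : Measure (Fin k → EuclideanSpace ℝ (Fin d))))
      (q := fun e y => t * G.Q (Sum.elim x y) e) (fun e => (G.measurable_Q x e).const_mul t)
      (fun e y => mul_nonneg ht.le (G.Q_nonneg _ e)) (fun β hβ => (hint β hβ).1)
      (multiplicityList n) α hα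
    rw [listDeriv_congr hU (fun β hβ => (hint β hβ).2) _ hα, listDeriv_const_mul,
      length_multiplicityList] at h6
    beta_reduce at h6
    rw [h6, ← mul_assoc, ← mul_pow, neg_one_mul, neg_neg, one_pow, one_mul, gaussMoment,
      ← integral_const_mul]
    congr 1
    ext y
    rw [prod_map_multiplicityList]
    simp only [mul_pow, Finset.prod_mul_distrib, Finset.prod_pow_eq_pow_sum, Pi.smul_apply,
      smul_eq_mul]
    rw [mul_assoc]
    congr 4
    exact Finset.sum_congr rfl fun e _ => by ring
  · have h1 := hgφ (fun j r => Real.Gamma (M + j) * r ^ (-(M + j)))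
      (fun j r hr => hasDerivAt_gamma_kernel hM j hr) α hα
    beta_reduce at h1
    rw [← h1]
    have h2 : Set.EqOn (fun β => G.gaussFactor d β * (Real.Gamma (M + (0 : ℕ)) *
        (G.PhiDual x β / G.PsiDual β) ^ (-(M + (0 : ℕ)))))
        (fun β => (√Real.pi ^ k) ^ d * Real.Gamma M * G.dualKernel x M β) (orthant (Fin N)) := by
      intro β hβ
      have h3 := G.gaussFactor_mul_rpow M (hΨ β hβ) (hΦ β hβ)
      simp only [Nat.cast_zero, add_zero]
      linear_combination Real.Gamma M * h3
    have h4 := listDeriv_congr hU h2 (multiplicityList n) hα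
    rw [listDeriv_const_mul] at h4
    exact h4.symm

/-! ### Schwinger representation, Tonelli and the radial integral -/

lemma prod_Gamma_mul_positionIntegrand (G : FeynmanGraph m k N) {lam : ℝ} {ν : Fin N → ℝ}
    {x : Fin m → EuclideanSpace ℝ (Fin d)} (n : Fin N → ℕ)
    {y : Fin k → EuclideanSpace ℝ (Fin d)} (hy : ∀ e, 0 < G.Q (Sum.elim x y) e) :
    (∏ e, Real.Gamma ((n e : ℝ) + lam * ν e)) * G.positionIntegrand lam ν x y =
      (∏ e, G.Q (Sum.elim x y) e ^ n e) * ∏ e, Real.Gamma ((n e : ℝ) + lam * ν e) *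
        G.Q (Sum.elim x y) e ^ (-((n e : ℝ) + lam * ν e)) := by
  rw [positionIntegrand, one_div, ← Finset.prod_inv_distrib, ← Finset.prod_mul_distrib,
    ← Finset.prod_mul_distrib]
  refine Finset.prod_congr rfl fun e _ => ?_
  rw [neg_add, Real.rpow_add (hy e), Real.rpow_neg (hy e).le, Real.rpow_neg (hy e).le,
    Real.rpow_natCast]
  have h1 := (pow_pos (hy e) (n e)).ne'
  have h2 := (Real.rpow_pos_of_pos (hy e) (lam * ν e)).ne'
  field_simp

/-- The integrand of the Schwinger representation. -/
def schwingerIntegrand (G : FeynmanGraph m k N) (x : Fin m → EuclideanSpace ℝ (Fin d))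
    (n : Fin N → ℕ) (A α : Fin N → ℝ) (y : Fin k → EuclideanSpace ℝ (Fin d)) : ℝ :=
  (∏ e, α e ^ (A e - 1)) * ((∏ e, G.Q (Sum.elim x y) e ^ n e) *
    Real.exp (-∑ e, α e * G.Q (Sum.elim x y) e))

lemma measurable_schwingerIntegrand (G : FeynmanGraph m k N)
    (x : Fin m → EuclideanSpace ℝ (Fin d)) (n : Fin N → ℕ) (A : Fin N → ℝ) :
    Measurable fun z : (Fin N → ℝ) × (Fin k → EuclideanSpace ℝ (Fin d)) =>
      G.schwingerIntegrand x n A z.1 z.2 := by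
  unfold schwingerIntegrand
  have hQ : ∀ e, Measurable fun z : (Fin N → ℝ) × (Fin k → EuclideanSpace ℝ (Fin d)) =>
    G.Q (Sum.elim x z.2) e := fun e => (G.measurable_Q x e).comp measurable_snd
  have hα : ∀ e, Measurable fun z : (Fin N → ℝ) × (Fin k → EuclideanSpace ℝ (Fin d)) =>
    z.1 e := fun e => (measurable_pi_apply e).comp measurable_fst
  refine (Finset.measurable_fun_prod _ fun e _ => (hα e).pow_const _).mul
    ((Finset.measurable_fun_prod _ fun e _ => (hQ e).pow_const _).mul ?_)
  exact (Finset.measurable_fun_sum _ fun e _ => (hα e).mul (hQ e)).neg.exp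

/-- Tonelli and Schwinger's formula; nonnegativity dispenses with any integrability of the joint
integrand, and the value is finite because the position space integral converges. -/
lemma lintegral_schwingerIntegrand (G : FeynmanGraph m k N) (hd : 0 < d) {lam : ℝ}
    {ν : Fin N → ℝ} {x : Fin m → EuclideanSpace ℝ (Fin d)} (hx : Function.Injective x)
    (hconv : G.Converges lam ν x) {n : Fin N → ℕ} (hn : ∀ e, 0 < (n e : ℝ) + lam * ν e) :
    ∫⁻ α in orthant (Fin N), ∫⁻ y, ENNReal.ofReal
        (G.schwingerIntegrand x n (fun e => (n e : ℝ) + lam * ν e) α y) =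
      ENNReal.ofReal ((∏ e, Real.Gamma ((n e : ℝ) + lam * ν e)) *
        ∫ y, G.positionIntegrand lam ν x y) := by
  have hΓ : 0 ≤ ∏ e, Real.Gamma ((n e : ℝ) + lam * ν e) :=
    Finset.prod_nonneg fun e _ => (Real.Gamma_pos_of_pos (hn e)).le
  rw [lintegral_lintegral_swap (G.measurable_schwingerIntegrand x n _).ennreal_ofReal.aemeasurable,
    ← integral_const_mul, ofReal_integral_eq_lintegral_ofReal (Integrable.const_mul hconv _)
      (Filter.Eventually.of_forall fun y => mul_nonneg hΓ (G.positionIntegrand_nonneg lam ν x y))]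
  refine lintegral_congr_ae ?_
  filter_upwards [G.ae_Q_pos hd hx] with y hy
  rw [G.prod_Gamma_mul_positionIntegrand n hy, ENNReal.ofReal_mul
    (Finset.prod_nonneg fun e _ => pow_nonneg (hy e).le _),
    ← lintegral_orthant_prod_rpow_mul_exp hn hy, ← lintegral_const_mul' _ _ ENNReal.ofReal_ne_top]
  refine lintegral_congr fun α => ?_
  rw [← ENNReal.ofReal_mul (Finset.prod_nonneg fun e _ => pow_nonneg (hy e).le _)]
  congr 1
  rw [schwingerIntegrand]
  ring

lemma lintegral_ofReal_schwingerIntegrand (G : FeynmanGraph m k N)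
    (x : Fin m → EuclideanSpace ℝ (Fin d)) (hΨ : ∀ α ∈ orthant (Fin N), 0 < G.PsiDual α)
    (n : Fin N → ℕ) (A : Fin N → ℝ) {α : Fin N → ℝ} (hα : α ∈ orthant (Fin N)) :
    ∫⁻ y, ENNReal.ofReal (G.schwingerIntegrand x n A α y) =
      ENNReal.ofReal ((∏ e, α e ^ (A e - 1)) * G.gaussMoment x n α) := by
  have hnn : 0 ≤ ∏ e, α e ^ (A e - 1) :=
    Finset.prod_nonneg fun e _ => Real.rpow_nonneg (hα e).le _
  rw [gaussMoment, ← integral_const_mul, ofReal_integral_eq_lintegral_ofReal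
    ((G.integrable_gaussMoment x hΨ n hα).const_mul _)]
  · rfl
  · exact Filter.Eventually.of_forall fun y => mul_nonneg hnn (mul_nonneg
      (Finset.prod_nonneg fun e _ => pow_nonneg (G.Q_nonneg _ e) _) (Real.exp_pos _).le)

lemma gaussMoment_nonneg (G : FeynmanGraph m k N) (x : Fin m → EuclideanSpace ℝ (Fin d))
    (n : Fin N → ℕ) (α : Fin N → ℝ) : 0 ≤ G.gaussMoment x n α :=
  integral_nonneg fun _ => mul_nonneg
    (Finset.prod_nonneg fun e _ => pow_nonneg (G.Q_nonneg _ e) _) (Real.exp_pos _).le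

/-- The value of a convergent radial integral, in terms of the dual integrand. -/
lemma lintegral_radial (G : FeynmanGraph m k N) (hN : 0 < N) {lam : ℝ} {ν : Fin N → ℝ}
    (x : Fin m → EuclideanSpace ℝ (Fin d))
    (hΨ : ∀ α ∈ orthant (Fin N), 0 < G.PsiDual α) (hΦ : ∀ α ∈ orthant (Fin N), 0 < G.PhiDual x α)
    (hM : ∀ j : ℕ, G.superficialDegree d lam ν ≠ -(j : ℝ)) (n : Fin N → ℕ) {α : Fin N → ℝ}
    (hα : α ∈ orthant (Fin N))
    (hfin : ∫⁻ t in Set.Ioi (0 : ℝ), ENNReal.ofReal (t ^ (N - 1)) * ∫⁻ y, ENNReal.ofReal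
      (G.schwingerIntegrand x n (fun e => (n e : ℝ) + lam * ν e) (t • α) y) ≠ ⊤) :
    0 ≤ (-1) ^ (∑ e, n e) * ((√Real.pi ^ k) ^ d * Real.Gamma (G.superficialDegree d lam ν)) *
        G.dualIntegrand lam ν x n α ∧
      ∫⁻ t in Set.Ioi (0 : ℝ), ENNReal.ofReal (t ^ (N - 1)) * ∫⁻ y, ENNReal.ofReal
        (G.schwingerIntegrand x n (fun e => (n e : ℝ) + lam * ν e) (t • α) y) =
      ENNReal.ofReal ((-1) ^ (∑ e, n e) * ((√Real.pi ^ k) ^ d *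
        Real.Gamma (G.superficialDegree d lam ν)) * G.dualIntegrand lam ν x n α) := by
  obtain ⟨L, g, -, hmom, hker⟩ := G.exists_gaussMoment_eq_sum x hΨ hΦ n
  set M := G.superficialDegree d lam ν with hMdef
  set u := G.PhiDual x α / G.PsiDual α with hu
  set B := ∏ e, α e ^ ((n e : ℝ) + lam * ν e - 1) with hB
  have hBpos : 0 < B := Finset.prod_pos fun e _ => Real.rpow_pos_of_pos (hα e) _
  have hupos : 0 < u := div_pos (hΦ α hα) (hΨ α hα)
  let S : ℝ → ℝ := fun t => t ^ (M - 1) *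
    ∑ j ∈ Finset.range L, (-1) ^ (∑ e, n e) * g j α * (t ^ j * Real.exp (-(t * u)))
  have hS : ∀ t ∈ Set.Ioi (0 : ℝ), t ^ (N - 1) * ((∏ e, (t • α) e ^ ((n e : ℝ) + lam * ν e - 1)) *
      G.gaussMoment x n (t • α)) = B * S t := by
    intro t ht
    have ht' : 0 < t := ht
    have h1 := hmom α hα t ht'
    have h2 : G.gaussMoment x n (t • α) = t ^ (-((∑ e, n e : ℕ) : ℝ)) *
        (t ^ (∑ e, n e) * G.gaussMoment x n (t • α)) := by
      rw [← mul_assoc, Real.rpow_neg ht'.le, Real.rpow_natCast,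
        inv_mul_cancel₀ (pow_pos ht' _).ne', one_mul]
    -- The Jacobian, the monomial, the insertions and the Gaussian factor contribute the exponents
    -- `N - 1`, `∑ (n_e + λν_e) - N`, `-∑ n_e` and `-dk/2`, with sum `M - 1`.
    have h3 : t ^ (N - 1) * t ^ (∑ e, ((n e : ℝ) + lam * ν e) - N) *
        t ^ (-((∑ e, n e : ℕ) : ℝ)) * t ^ (-((d : ℝ) / 2 * k)) = t ^ (M - 1) := by
      rw [← Real.rpow_natCast, ← Real.rpow_add ht', ← Real.rpow_add ht', ← Real.rpow_add ht']
      congr 1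
      rw [hMdef, superficialDegree, Finset.sum_add_distrib, ← Finset.mul_sum,
        Nat.cast_sub (Nat.one_le_iff_ne_zero.2 hN.ne')]
      push_cast
      ring
    rw [prod_smul_rpow (A := fun e => (n e : ℝ) + lam * ν e) ht' hα, h2, h1]
    simp only [S, mul_assoc, ← Finset.mul_sum]
    rw [← h3]
    ring
  have hSnn : ∀ t ∈ Set.Ioi (0 : ℝ), 0 ≤ B * S t := fun t ht => by
    rw [← hS t ht]
    exact mul_nonneg (pow_nonneg (le_of_lt ht) _) (mul_nonneg (Finset.prod_nonneg fun e _ =>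
      Real.rpow_nonneg (smul_mem_orthant ht hα e).le _) (G.gaussMoment_nonneg x n _))
  have hlin : ∫⁻ t in Set.Ioi (0 : ℝ), ENNReal.ofReal (t ^ (N - 1)) * ∫⁻ y, ENNReal.ofReal
      (G.schwingerIntegrand x n (fun e => (n e : ℝ) + lam * ν e) (t • α) y) =
      ∫⁻ t in Set.Ioi (0 : ℝ), ENNReal.ofReal (B * S t) := by
    refine setLIntegral_congr_fun measurableSet_Ioi fun t ht => ?_
    rw [G.lintegral_ofReal_schwingerIntegrand x hΨ n _ (smul_mem_orthant ht hα),
      ← ENNReal.ofReal_mul (pow_nonneg (le_of_lt ht) _), hS t ht]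
  have hSm : Measurable S :=
    (measurable_id.pow_const _).mul (Continuous.measurable (by fun_prop))
  have hnn : ∀ᵐ t ∂volume.restrict (Set.Ioi (0 : ℝ)), 0 ≤ B * S t :=
    (ae_restrict_iff' measurableSet_Ioi).2 (Filter.Eventually.of_forall hSnn)
  have hint : IntegrableOn (fun t => B * S t) (Set.Ioi 0) := by
    refine ⟨(hSm.const_mul B).aestronglyMeasurable, ?_⟩
    rw [hasFiniteIntegral_iff_ofReal hnn, ← hlin]
    exact hfin.lt_top
  have hintS : IntegrableOn S (Set.Ioi 0) := by
    have := Integrable.const_mul hint B⁻¹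
    simp only [inv_mul_cancel_left₀ hBpos.ne'] at this
    exact this
  -- Convergence of `S` makes the continued Mellin formula available; its value is the same sum over
  -- the `g j` as the derivative of the dual kernel.
  have hval : ∫ t in Set.Ioi (0 : ℝ), B * S t = (-1) ^ (∑ e, n e) * ((√Real.pi ^ k) ^ d *
      Real.Gamma M) * G.dualIntegrand lam ν x n α := by
    rw [integral_const_mul, integral_rpow_mul_sum_mul_exp hupos L M hM _ hintS, dualIntegrand_eq,
      ← hMdef, ← hB]
    have h1 := hker α hα M hM
    simp only [mul_assoc, ← Finset.mul_sum] at h1 ⊢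
    rw [← h1]
    ring
  rw [hlin, ← hval]
  exact ⟨setIntegral_nonneg measurableSet_Ioi hSnn,
    (ofReal_integral_eq_lintegral_ofReal hint hnn).symm⟩

/-- Supplies the measurability of the chart integrand. The explicit sum for the derivative is
divided by `Γ(M_G)`, which is nonzero away from the poles. -/
lemma continuousOn_dualIntegrand (G : FeynmanGraph m k N) {lam : ℝ} {ν : Fin N → ℝ}
    (x : Fin m → EuclideanSpace ℝ (Fin d))
    (hΨ : ∀ α ∈ orthant (Fin N), 0 < G.PsiDual α) (hΦ : ∀ α ∈ orthant (Fin N), 0 < G.PhiDual x α)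
    (hM : ∀ j : ℕ, G.superficialDegree d lam ν ≠ -(j : ℝ)) (n : Fin N → ℕ) :
    ContinuousOn (G.dualIntegrand lam ν x n) (orthant (Fin N)) := by
  obtain ⟨L, g, hg, -, hker⟩ := G.exists_gaussMoment_eq_sum x hΨ hΦ n
  set M := G.superficialDegree d lam ν with hMdef
  have hC : (√Real.pi ^ k) ^ d * Real.Gamma M ≠ 0 :=
    mul_ne_zero (by positivity) (Real.Gamma_ne_zero hM)
  have hu : ContinuousOn (fun α => G.PhiDual x α / G.PsiDual α) (orthant (Fin N)) :=
    (G.contDiff_PhiDual x).continuous.continuousOn.div G.contDiff_PsiDual.continuous.continuousOn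
      fun α hα => (hΨ α hα).ne'
  have h1 : ContinuousOn (fun α => (∏ e, α e ^ ((n e : ℝ) + lam * ν e - 1)) *
      (((√Real.pi ^ k) ^ d * Real.Gamma M)⁻¹ * ∑ j ∈ Finset.range L, g j α *
        (Real.Gamma (M + j) * (G.PhiDual x α / G.PsiDual α) ^ (-(M + j))))) (orthant (Fin N)) := by
    refine ContinuousOn.mul (continuousOn_finsetProd _ fun e _ => ?_)
      (continuousOn_const.mul (continuousOn_finsetSum _ fun j _ => (hg j).mul
        (continuousOn_const.mul (hu.rpow_const fun α hα => Or.inl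
          (div_pos (hΦ α hα) (hΨ α hα)).ne'))))
    exact (continuous_apply e).continuousOn.rpow_const fun α hα => Or.inl (hα e).ne'
  refine h1.congr fun α hα => ?_
  beta_reduce
  rw [dualIntegrand_eq, ← hMdef, ← hker α hα M hM, inv_mul_cancel_left₀ hC]

/-- The parametric integral in an affine chart. -/
lemma integral_chart (G : FeynmanGraph m k N) (hd : 0 < d) (hN : 0 < N) {lam : ℝ} {ν : Fin N → ℝ}
    {x : Fin m → EuclideanSpace ℝ (Fin d)} (hx : Function.Injective x)
    (hconv : G.Converges lam ν x) (hM : ∀ j : ℕ, G.superficialDegree d lam ν ≠ -(j : ℝ))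
    {n : Fin N → ℕ} (hn : ∀ e, 0 < (n e : ℝ) + lam * ν e) (e₀ : Fin N) :
    IntegrableOn (fun b => G.dualIntegrand lam ν x n (affineChart e₀ b))
        (orthant {e : Fin N // e ≠ e₀}) ∧
      (-1) ^ (∑ e, n e) * ((√Real.pi ^ k) ^ d * Real.Gamma (G.superficialDegree d lam ν)) *
        ∫ b in orthant {e : Fin N // e ≠ e₀}, G.dualIntegrand lam ν x n (affineChart e₀ b) =
      (∏ e, Real.Gamma ((n e : ℝ) + lam * ν e)) * ∫ y, G.positionIntegrand lam ν x y := by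
  have hM0 : G.superficialDegree d lam ν ≠ 0 := by simpa using hM 0
  have hΨ : ∀ α ∈ orthant (Fin N), 0 < G.PsiDual α := fun α hα => G.PsiDual_pos hd hx hconv hα
  have hΦ : ∀ α ∈ orthant (Fin N), 0 < G.PhiDual x α := fun α hα =>
    G.PhiDual_pos hd hx hconv hM0 hα
  set c : ℝ := (-1) ^ (∑ e, n e) * ((√Real.pi ^ k) ^ d *
    Real.Gamma (G.superficialDegree d lam ν)) with hc
  have hc0 : c ≠ 0 := mul_ne_zero (pow_ne_zero _ (by norm_num))
    (mul_ne_zero (by positivity) (Real.Gamma_ne_zero hM))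
  let f : (Fin N → ℝ) → ENNReal := fun α => ∫⁻ y, ENNReal.ofReal
    (G.schwingerIntegrand x n (fun e => (n e : ℝ) + lam * ν e) α y)
  have hf : Measurable f :=
    (G.measurable_schwingerIntegrand x n _).ennreal_ofReal.lintegral_prod_right'
  have htot := G.lintegral_schwingerIntegrand hd hx hconv hn
  rw [lintegral_orthant_eq_lintegral_chart e₀ hf] at htot
  have hchart := (continuous_affineChart e₀).measurable
  have hinner : Measurable fun b => ∫⁻ t in Set.Ioi (0 : ℝ),
      ENNReal.ofReal (t ^ (N - 1)) * f (t • affineChart e₀ b) := by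
    refine Measurable.lintegral_prod_right' (f := fun z : ({e : Fin N // e ≠ e₀} → ℝ) × ℝ =>
      ENNReal.ofReal (z.2 ^ (N - 1)) * f (z.2 • affineChart e₀ z.1)) ?_
    exact (measurable_snd.pow_const _).ennreal_ofReal.mul
      (hf.comp (measurable_snd.smul (hchart.comp measurable_fst)))
  -- The total is finite, so the radial integral converges on almost every ray; on those rays the
  -- dual integrand, multiplied by `c`, is nonnegative and equals it.
  have hfin := ae_lt_top hinner (htot ▸ ENNReal.ofReal_ne_top)
  have hmem : ∀ᵐ b ∂volume.restrict (orthant {e : Fin N // e ≠ e₀}),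
      b ∈ orthant {e : Fin N // e ≠ e₀} := ae_restrict_mem (measurableSet_orthant _)
  have hnn : ∀ᵐ b ∂volume.restrict (orthant {e : Fin N // e ≠ e₀}),
      0 ≤ c * G.dualIntegrand lam ν x n (affineChart e₀ b) := by
    filter_upwards [hfin, hmem] with b hb hb'
    exact (G.lintegral_radial hN x hΨ hΦ hM n (affineChart_mem_orthant hb') hb.ne).1
  have hlin : ∫⁻ b in orthant {e : Fin N // e ≠ e₀},
      ENNReal.ofReal (c * G.dualIntegrand lam ν x n (affineChart e₀ b)) =
      ENNReal.ofReal ((∏ e, Real.Gamma ((n e : ℝ) + lam * ν e)) *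
        ∫ y, G.positionIntegrand lam ν x y) := by
    rw [← htot]
    refine lintegral_congr_ae ?_
    filter_upwards [hfin, hmem] with b hb hb'
    exact (G.lintegral_radial hN x hΨ hΦ hM n (affineChart_mem_orthant hb') hb.ne).2.symm
  have hcont : ContinuousOn (fun b => c * G.dualIntegrand lam ν x n (affineChart e₀ b))
      (orthant {e : Fin N // e ≠ e₀}) :=
    continuousOn_const.mul ((G.continuousOn_dualIntegrand x hΨ hΦ hM n).comp
      (continuous_affineChart e₀).continuousOn fun b hb => affineChart_mem_orthant hb)
  have hint : IntegrableOn (fun b => c * G.dualIntegrand lam ν x n (affineChart e₀ b))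
      (orthant {e : Fin N // e ≠ e₀}) := by
    refine ⟨hcont.aestronglyMeasurable (measurableSet_orthant _), ?_⟩
    rw [hasFiniteIntegral_iff_ofReal hnn, hlin]
    exact ENNReal.ofReal_lt_top
  constructor
  · have := Integrable.const_mul hint c⁻¹
    simp only [inv_mul_cancel_left₀ hc0] at this
    exact this
  · rw [← integral_const_mul]
    have h1 := ofReal_integral_eq_lintegral_ofReal hint hnn
    rw [hlin, ENNReal.ofReal_eq_ofReal_iff (integral_nonneg_of_ae hnn)] at h1
    · exact h1
    · exact mul_nonneg (Finset.prod_nonneg fun e _ => (Real.Gamma_pos_of_pos (hn e)).le)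
        (integral_nonneg fun y => G.positionIntegrand_nonneg lam ν x y)

end FeynmanGraph

end

/-- The dual parametric representation of a convergent position space Feynman integral. The
hypothesis `hM` says that the factor `Γ(M_G)` is not at a pole. -/
theorem theorem1p2 {m k N d : ℕ} (lam : ℝ) (hd : (d : ℝ) = 2 * lam + 2) (hlam : 0 < lam)
    (hN : 0 < N) (G : FeynmanGraph m k N) (ν : Fin N → ℝ)
    (x : Fin m → EuclideanSpace ℝ (Fin d)) (hx : Function.Injective x)
    (hconv : G.Converges lam ν x)
    (hM : ∀ j : ℕ, G.superficialDegree d lam ν ≠ -(j : ℝ))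
    (n : Fin N → ℕ) (hn : ∀ e, 0 < (n e : ℝ) + lam * ν e) :
    ConvergentProjective (G.dualIntegrand lam ν x n) ∧
      ∀ e₀ : Fin N, G.feynmanIntegral lam ν x =
        (-1) ^ (∑ e, n e) * Real.Gamma (G.superficialDegree d lam ν) /
            (∏ e, Real.Gamma ((n e : ℝ) + lam * ν e)) *
          projectiveIntegral e₀ (G.dualIntegrand lam ν x n) := by
  have hd0 : 0 < d := by
    have : (0 : ℝ) < d := by linarith
    exact_mod_cast this
  refine ⟨⟨fun α hα t ht => ?_, fun e₀ => (G.integral_chart hd0 hN hx hconv hM hn e₀).1⟩,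
    fun e₀ => ?_⟩
  · exact G.dualIntegrand_homogeneous hd0 hx hconv (by simpa using hM 0) n hα ht
  · have h := (G.integral_chart hd0 hN hx hconv hM hn e₀).2
    have hΓ : ∏ e, Real.Gamma ((n e : ℝ) + lam * ν e) ≠ 0 :=
      Finset.prod_ne_zero_iff.2 fun e _ => (Real.Gamma_pos_of_pos (hn e)).ne'
    have hC : (Real.pi ^ ((d : ℝ) / 2)) ^ k = (√Real.pi ^ k) ^ d := by
      rw [← FeynmanGraph.sqrt_pow_eq_rpow Real.pi_pos.le, ← pow_mul, ← pow_mul, mul_comm]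
    have hC0 : (√Real.pi ^ k) ^ d ≠ 0 := by positivity
    rw [FeynmanGraph.feynmanIntegral, hC]
    change _ = _ * ∫ b in orthant {e : Fin N // e ≠ e₀},
      G.dualIntegrand lam ν x n (affineChart e₀ b)
    rw [one_div, inv_mul_eq_iff_eq_mul₀ hC0, div_mul_eq_mul_div, mul_div_assoc', eq_div_iff hΓ]
    linear_combination -h
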